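/- **Setting.** A *graded graph* $\Gamma=(V,E,h,m)$ is a locally finite directed graph with edge set $E\subset V^2$, a grading $h:V\to\mathbb Z_{\ge0}$ with $h(w)=h(v)+1$ for every edge $(v,w)$, and an edge multiplicity $m(v,w)\in\mathbb Z_{\ge0}$. Its up and down operators on $\mathbb ZV$ are $U_\Gamma v=\sum_{(v,w)\in E}m(v,w)w$ and $D_\Gamma w=\sum_{(v,w)\in E}m(v,w)v$. Two graded graphs $(\Gamma,\Gamma')$ with the same vertices and grading are *dual with differential coefficient $r$* if $D_{\Gamma'}U_\Gamma-U_\Gamma D_{\Gamma'}=r\,\mathrm{Id}$. Let $\mathcal{UD}_{xy}$ be the set of $(z,m,m')$ with $(z,y)\in E$, $(z,x)\in E'$, $1\le m\le m_\Gamma(z,y)$, $1\le m'\le m_{\Gamma'}(z,x)$, and $\mathcal{DU}_{xy}$ the set of $(w,M,M')$ with $(x,w)\in E$, $(y,w)\in E'$, $1\le M\le m_\Gamma(x,w)$, $1\le M'\le m_{\Gamma'}(y,w)$. A *differential bijection* $\Phi$ for $(\Gamma,\Gamma')$ consists of bijections $\Phi_{xy}:\mathcal{UD}_{xy}\to\mathcal{DU}_{xy}$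 for all $x\ne y$ and $\Phi_x:\{1,\dots,r\}\sqcup\mathcal{UD}_{xx}\to\mathcal{DU}_{xx}$ for all $x$. It induces, through Fomin's local rules for growth diagrams, for each $n$ a map $I_\Phi$ from the $r$-coloured permutations of $n$ elements to the pairs $(P,Q)$ of a $\Gamma$-tableau and a $\Gamma'$-tableau (marked paths of length $n$ from the minimum) ending at the same vertex of degree $n$; $I_\Phi$ is called a *Schensted bijection* if these maps are well defined and bijective. For a generalized Cartan matrix (GCM) $A=(a_{ij})_{i,j\in I}$, $I$ finite, let $W_A$ be the Weyl group of the Kac–Moody algebra $\mathfrak g(A)$, with simple reflections $s_i$ and length $\ell$, and let $\Lambda_i$ be the fundamental weights. For a dominant integral weight $\Lambda$, $\Gamma_s^A(\Lambda)$ is the graph on $W_A$, graded by $\ell$, with an edge $v\to w$ whenever $w=vs_\alpha$ for a positive real root $\alpha$ and $\ell(w)=\ell(v)+1$, of multiplicity $\langle\alpha^\vee,\Lambda\rangle$. For $K=\sum_ik_i\alpha_i^\vee$ with $k_i\in\mathbb Z_{\ge0}$ in the centre of $\mathfrak g(A)$ (that is, $\sum_ik_ia_{ij}=0$ for all $j$),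 $\Gamma_w^A(K)$ is the graph on $W_A$, graded by $\ell$, with an edge $v\to s_iv$ of multiplicity $k_i$ whenever $\ell(s_iv)=\ell(v)+1$. Let $B=(b_{jk})_{j,k\in J}$ be a GCM, $J$ finite, and $\pi$ an admissible automorphism of $B$: a permutation of $J$ with $b_{\pi(j)\pi(k)}=b_{jk}$, and $b_{jk}=0$ for distinct $j,k$ in one $\pi$-orbit. Let $I$ index the $\pi$-orbits $O_i\subset J$, let $o_i=|O_i|$, and let the GCM $A$ be obtained from $(B,\pi)$ by folding: $a_{i'i}=\frac{o_{i'}}{o_i}\sum_{j\in O_i}b_{j'j}$ for all $i,i'\in I$ and $j'\in O_{i'}$. Write $\beta_j^\vee$, $\omega_j$ for the simple coroots and fundamental weights of $\mathfrak g(B)$, and put $\varphi(\sum_ik_i\alpha_i^\vee)=\sum_ik_i\sum_{j\in O_i}\beta_j^\vee$. **Proposition.** Let $K=\sum_ik_i\alpha_i^\vee$ be as above, $i'\in I$ and $j'\in O_{i'}$. Then $\varphi(K)$ is central in $\mathfrak g(B)$, and $(\Gamma_s^B(\omega_{j'}),\Gamma_w^B(\varphi(K)))$ and $(\Gamma_s^A(\Lambda_{i'}),\Gamma_w^A(K))$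 are pairs of dual graded graphs with the same differential coefficient $r=k_{i'}$. There is an injective group homomorphism $f:W_A\to W_B$ with $f(s_i)=\prod_{j\in O_i}s_j$. For every $v\in W_A$ and $i\in I$ the numbers of markings satisfy the following: if $\ell(s_iv)>\ell(v)$, the markings of the strong edge $v\to s_iv$ can be put in bijection with the disjoint union over $j\in O_i$ of the markings of the strong edges $f(v)\to s_jf(v)$, and, for each $j\in O_i$, the markings of the weak edge $v\to s_iv$ with those of the weak edge $f(v)\to s_jf(v)$; if $\ell(s_iv)<\ell(v)$, the same holds for the edges $s_iv\to v$ and $s_jf(v)\to f(v)$. Any choice of such bijections induces bijections $\mathcal{UD}^A_{vv}\to\mathcal{UD}^B_{f(v)f(v)}$ and $\mathcal{DU}^A_{vv}\to\mathcal{DU}^B_{f(v)f(v)}$ for all $v\in W_A$. With respect to them, every differential bijection $\Phi^B$ for $(\Gamma_s^B(\omega_{j'}),\Gamma_w^B(\varphi(K)))$ restricts to a differential bijection $\Phi^A$ for $(\Gamma_s^A(\Lambda_{i'}),\Gamma_w^A(K))$: there is exactly one differential bijection $\Phi^A$ such that $\Phi^A_v$ corresponds to $\Phi^B_{f(v)}$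 for every $v\in W_A$ (with the identity on $\{1,\dots,r\}$), and such that for $x\neq y$ the map $\Phi^A_{xy}$ is the natural one, which sends a path $x\to s_ix\to s_ixs_\alpha=y$ (down in the weak graph, up in the strong graph) to the path $x\to xs_\alpha\to s_ixs_\alpha=y$ with the same markings. The induced map $I_{\Phi^A}$ (folded insertion) is a Schensted bijection for $(\Gamma_s^A(\Lambda_{i'}),\Gamma_w^A(K))$. -/

import Mathlib

noncomputable section

/-! ### Graded graphs, duality, differential bijections -/

/-- A locally finite graded graph with vertex set `V`: a set of directed edges, a grading that goes
up by one along every edge, and a multiplicity for every edge (the value of `mult` at a pair that is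
not an edge is never used). -/
structure GradedGraph (V : Type*) where
  /-- The edge relation. -/
  Adj : V → V → Prop
  /-- The grading function. -/
  h : V → ℕ
  /-- The multiplicity of an edge. -/
  mult : V → V → ℕ
  h_adj : ∀ v w, Adj v w → h w = h v + 1
  finite_out : ∀ v, {w | Adj v w}.Finite
  finite_in : ∀ w, {v | Adj v w}.Finite

namespace GradedGraph

variable {V : Type*}

/-- The up operator `U` on the free abelian group on `V`. -/
def up (Γ : GradedGraph V) : (V →₀ ℤ) →ₗ[ℤ] (V →₀ ℤ) :=
  Finsupp.linearCombination ℤ fun v =>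
    ∑ w ∈ (Γ.finite_out v).toFinset, Finsupp.single w (Γ.mult v w : ℤ)

/-- The down operator `D` on the free abelian group on `V`. -/
def down (Γ : GradedGraph V) : (V →₀ ℤ) →ₗ[ℤ] (V →₀ ℤ) :=
  Finsupp.linearCombination ℤ fun w =>
    ∑ v ∈ (Γ.finite_in w).toFinset, Finsupp.single v (Γ.mult v w : ℤ)

/-- `(Γ, Γ')` is a pair of dual graded graphs with differential coefficient `r`:
same grading, and `D_{Γ'} U_Γ - U_Γ D_{Γ'} = r Id`. -/
def IsDual (Γ Γ' : GradedGraph V) (r : ℕ) : Prop :=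
  (∀ v, Γ.h v = Γ'.h v) ∧
    Γ'.down ∘ₗ Γ.up - Γ.up ∘ₗ Γ'.down = (r : ℤ) • LinearMap.id

/-- Marked paths `(z, m, m')` going down from `x` to `z` in `Γ'` (marking `m'`) and then up from `z`
to `y` in `Γ` (marking `m`). -/
def UD (Γ Γ' : GradedGraph V) (x y : V) : Set (V × ℕ × ℕ) :=
  {t | Γ.Adj t.1 y ∧ Γ'.Adj t.1 x ∧
    t.2.1 ∈ Set.Icc 1 (Γ.mult t.1 y) ∧ t.2.2 ∈ Set.Icc 1 (Γ'.mult t.1 x)}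

/-- Marked paths `(w, M, M')` going up from `x` to `w` in `Γ` (marking `M`) and then down from `w`
to `y` in `Γ'` (marking `M'`). -/
def DU (Γ Γ' : GradedGraph V) (x y : V) : Set (V × ℕ × ℕ) :=
  {t | Γ.Adj x t.1 ∧ Γ'.Adj y t.1 ∧
    t.2.1 ∈ Set.Icc 1 (Γ.mult x t.1) ∧ t.2.2 ∈ Set.Icc 1 (Γ'.mult y t.1)}

end GradedGraph

open GradedGraph in
/-- A differential bijection for `(Γ, Γ')` with differential coefficient `r`; the set `S(r)` with
`r` elements is `Fin r`. -/
structure DifferentialBijection {V : Type*} (Γ Γ' : GradedGraph V) (r : ℕ) where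
  /-- The off-diagonal part. -/
  off : ∀ x y : V, x ≠ y → (UD Γ Γ' x y ≃ DU Γ Γ' x y)
  /-- The diagonal part. -/
  diag : ∀ x : V, (Fin r ⊕ UD Γ Γ' x x) ≃ DU Γ Γ' x x

/-! ### Schensted bijections -/

/-- A standard `Γ`-tableau of length `n` starting at `b`: a marked directed path
`b = v₀ → v₁ → ⋯ → vₙ`. -/
structure Tableau {V : Type*} (Γ : GradedGraph V) (b : V) (n : ℕ) where
  /-- The vertices of the path. -/
  vert : Fin (n + 1) → V
  /-- The markings of its edges. -/
  mark : Fin n → ℕ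
  start : vert 0 = b
  adj : ∀ k : Fin n, Γ.Adj (vert k.castSucc) (vert k.succ)
  mark_mem : ∀ k : Fin n, mark k ∈ Set.Icc 1 (Γ.mult (vert k.castSucc) (vert k.succ))

/-- Pairs `(P, Q)` of a `Γ`-tableau and a `Γ'`-tableau of length `n` of the same shape (if `b` has
degree `0`, this shape is a vertex of degree `n`). -/
abbrev TableauPair {V : Type*} (Γ Γ' : GradedGraph V) (b : V) (n : ℕ) :=
  {PQ : Tableau Γ b n × Tableau Γ' b n // PQ.1.vert (Fin.last n) = PQ.2.vert (Fin.last n)}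

/-- `r`-coloured permutations of `n` elements, as a permutation with a colour for every row. -/
abbrev ColoredPerm (n r : ℕ) := Equiv.Perm (Fin n) × (Fin n → Fin r)

/-- The entries of the monomial matrix of a coloured permutation (`none` is the entry `0`). -/
def ColoredPerm.entry {n r : ℕ} (σ : ColoredPerm n r) (i j : Fin n) : Option (Fin r) :=
  if σ.1 i = j then some (σ.2 i) else none

/-- The underlying data of a growth diagram: the vertices `G i j` for `0 ≤ i, j ≤ n`, the markings
`row i j` of the horizontal steps `G i j → G i (j + 1)` and the markings `col i j` of the vertical
steps `G i j → G (i + 1) j`. A degenerate step, between equal vertices, gets the marking `0`. -/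
structure GrowthDiagram (V : Type*) (n : ℕ) where
  /-- The vertices. -/
  vert : Fin (n + 1) → Fin (n + 1) → V
  /-- The markings of the horizontal steps. -/
  row : Fin (n + 1) → Fin n → ℕ
  /-- The markings of the vertical steps. -/
  col : Fin n → Fin (n + 1) → ℕ

namespace DifferentialBijection

open GradedGraph

variable {V : Type*} {Γ Γ' : GradedGraph V} {r : ℕ}

/-- Fomin's local rule for a square with corners `z` (north-west), `y` (north-east),
`x` (south-west), `w` (south-east), edge markings `m : z → y`, `m' : z → x`, `M : x → w`,
`M' : y → w`, and matrix entry `c`. -/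
def LocalRule (Φ : DifferentialBijection Γ Γ' r) (c : Option (Fin r)) (z y x w : V)
    (m m' M M' : ℕ) : Prop :=
  (z = x → z = y → c = none → w = z ∧ M = 0 ∧ M' = 0) ∧
  (z = x → z = y → ∀ k, c = some k → (Φ.diag x (Sum.inl k)).1 = (w, M, M')) ∧
  (z ≠ x → x = y → ∃ ht : (z, m, m') ∈ UD Γ Γ' x x,
    (Φ.diag x (Sum.inr ⟨(z, m, m'), ht⟩)).1 = (w, M, M')) ∧
  (z = y → z ≠ x → w = x ∧ M = 0 ∧ M' = m') ∧
  (z = x → z ≠ y → w = y ∧ M = m ∧ M' = 0) ∧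
  (z ≠ x → z ≠ y → ∀ hxy : x ≠ y, ∃ ht : (z, m, m') ∈ UD Γ Γ' x y,
    (Φ.off x y hxy ⟨(z, m, m'), ht⟩).1 = (w, M, M'))

/-- `G` is the growth diagram of `σ` for `Φ`: its north and west edges are the empty tableau at the
minimum `b`, and every square obeys the local rule. -/
def IsGrowth (Φ : DifferentialBijection Γ Γ' r) (b : V) {n : ℕ} (σ : ColoredPerm n r)
    (G : GrowthDiagram V n) : Prop :=
  (∀ j, G.vert 0 j = b) ∧ (∀ i, G.vert i 0 = b) ∧ (∀ j, G.row 0 j = 0) ∧ (∀ i, G.col i 0 = 0) ∧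
  ∀ i j : Fin n, Φ.LocalRule (σ.entry i j)
    (G.vert i.castSucc j.castSucc) (G.vert i.castSucc j.succ)
    (G.vert i.succ j.castSucc) (G.vert i.succ j.succ)
    (G.row i.castSucc j) (G.col i j.castSucc) (G.row i.succ j) (G.col i j.succ)

/-- `Φ` induces a Schensted bijection: every coloured permutation has exactly one growth diagram,
and reading off its south edge `P` and its east edge `Q` is, for every `n`, a bijection from the
`r`-coloured permutations of `n` elements to the pairs of tableaux of the same shape. -/
def InducesSchensted (Φ : DifferentialBijection Γ Γ' r) (b : V) : Prop :=
  ∀ n : ℕ, (∀ σ : ColoredPerm n r, ∃! G : GrowthDiagram V n, Φ.IsGrowth b σ G) ∧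
    ∃ S : ColoredPerm n r ≃ TableauPair Γ Γ' b n,
      ∀ (σ : ColoredPerm n r) (G : GrowthDiagram V n), Φ.IsGrowth b σ G →
        (∀ k, (S σ).1.1.vert k = G.vert (Fin.last n) k) ∧
        (∀ k, (S σ).1.1.mark k = G.row (Fin.last n) k) ∧
        (∀ k, (S σ).1.2.vert k = G.vert k (Fin.last n)) ∧
        (∀ k, (S σ).1.2.mark k = G.col k (Fin.last n))

end DifferentialBijection

/-! ### Generalized Cartan matrices, Weyl groups, real roots -/

/-- A generalized Cartan matrix `a i j = ⟨αᵢ^∨, αⱼ⟩`. -/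
structure GCM (I : Type*) where
  /-- The entries. -/
  a : Matrix I I ℤ
  diag : ∀ i, a i i = 2
  nonpos : ∀ i j, i ≠ j → a i j ≤ 0
  neg_iff : ∀ i j, i ≠ j → (a i j < 0 ↔ a j i < 0)

namespace GCM

theorem zero_iff {I : Type*} (A : GCM I) {i j : I} (h : i ≠ j) : A.a i j = 0 ↔ A.a j i = 0 := by
  have h1 := A.nonpos i j h
  have h2 := A.nonpos j i h.symm
  have h3 := A.neg_iff i j h
  omega

/-- `m i j` as a function of `a i j * a j i`; the value `0` stands for `∞`. -/
def coxeterEntry (n : ℤ) : ℕ :=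
  if n = 0 then 2 else if n = 1 then 3 else if n = 2 then 4 else if n = 3 then 6 else 0

section

variable {I : Type*} [DecidableEq I]

/-- The Coxeter matrix of the Weyl group of `𝔤(A)`. -/
def coxeterMatrix (A : GCM I) : CoxeterMatrix I where
  M := Matrix.of fun i j => if i = j then 1 else coxeterEntry (A.a i j * A.a j i)
  isSymm := by
    ext i j
    simp only [Matrix.transpose_apply, Matrix.of_apply, eq_comm (a := j), mul_comm (A.a j i)]
  diagonal i := by simp
  off_diagonal i j h := by
    simp only [Matrix.of_apply, h, if_false, coxeterEntry]
    split_ifs <;> decide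

/-- The Weyl group of `𝔤(A)`, by generators and relations. -/
abbrev Weyl (A : GCM I) : Type _ := A.coxeterMatrix.Group

/-- The Weyl group as a Coxeter system. -/
abbrev cs (A : GCM I) : CoxeterSystem A.coxeterMatrix A.Weyl := A.coxeterMatrix.toCoxeterSystem

/-- The simple reflection `sᵢ`. -/
abbrev s (A : GCM I) (i : I) : A.Weyl := A.cs.simple i

/-- The length function. -/
abbrev len (A : GCM I) (w : A.Weyl) : ℕ := A.cs.length w

variable [Fintype I]

/-- The simple reflection on the coroot lattice `⊕ ℤ αᵢ^∨`, in coordinates: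
`x ↦ x - ⟨x, αᵢ⟩ αᵢ^∨`. -/
def corootRefl (A : GCM I) (i : I) : Module.End ℤ (I → ℤ) :=
  LinearMap.id - (Fintype.linearCombination ℤ fun k => A.a k i).smulRight (Pi.single i (1 : ℤ))

/-- The simple reflection on the root lattice `⊕ ℤ αᵢ`, in coordinates:
`y ↦ y - ⟨αᵢ^∨, y⟩ αᵢ`. -/
def rootRefl (A : GCM I) (i : I) : Module.End ℤ (I → ℤ) :=
  LinearMap.id - (Fintype.linearCombination ℤ fun k => A.a i k).smulRight (Pi.single i (1 : ℤ))

theorem refl_pow {M : Type*} [AddCommGroup M] (φ ψ : M →ₗ[ℤ] ℤ) (e g : M) (c d : ℤ)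
    (he : φ e = 2) (hg : ψ g = 2) (hc : φ g = c) (hd : ψ e = d) (hcd : c = 0 ↔ d = 0) :
    (((LinearMap.id - φ.smulRight e : Module.End ℤ M) *
      (LinearMap.id - ψ.smulRight g : Module.End ℤ M)) ^ coxeterEntry (c * d)) = 1 := by
  set T : Module.End ℤ M := (LinearMap.id - φ.smulRight e) * (LinearMap.id - ψ.smulRight g) with hT
  have step : ∀ (x : M) (u v : ℤ), T (x + u • e + v • g) =
      x + (u - (φ x + 2 * u + c * v) + c * (ψ x + u * d + 2 * v)) • e
        + (v - (ψ x + u * d + 2 * v)) • g := by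
    intro x u v
    simp only [hT, Module.End.mul_apply, LinearMap.sub_apply, LinearMap.id_apply,
      LinearMap.smulRight_apply, map_sub, map_add, map_smul, he, hg, hc, hd, smul_eq_mul]
    module
  have key : ∀ n : ℕ, (∀ (x : M), (T ^ n) (x + (0 : ℤ) • e + (0 : ℤ) • g)
      = x + (0 : ℤ) • e + (0 : ℤ) • g) → T ^ n = 1 := by
    intro n h
    ext x
    simpa using h x
  unfold coxeterEntry
  split_ifs with h0 h1 h2 h3
  · have hc' : c = 0 := by
      rcases mul_eq_zero.1 h0 with h | h
      · exact h
      · exact hcd.2 h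
    have hd' : d = 0 := hcd.1 hc'
    subst hc' hd'
    refine key _ fun x => ?_
    simp only [pow_succ', pow_zero, mul_one, Module.End.mul_apply, step]
    module
  · refine key _ fun x => ?_
    simp only [pow_succ', pow_zero, mul_one, Module.End.mul_apply, step]
    congr 2
    · congr 1; linear_combination ((-2) * (ψ x) * c + (-1) * (φ x) * c * d + (1) * (ψ x) * c^2 * d + (1) * (φ x)) * h1
    · congr 1; linear_combination ((1) * (ψ x) + (1) * (φ x) * d + (-1) * (ψ x) * c * d) * h1
  · refine key _ fun x => ?_
    simp only [pow_succ', pow_zero, mul_one, Module.End.mul_apply, step]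
    congr 2
    · congr 1; linear_combination ((1) * (ψ x) * c + (-3) * (ψ x) * c^2 * d + (-1) * (φ x) * c^2 * d^2 + (1) * (ψ x) * c^3 * d^2 + (2) * (φ x) * c * d) * h2
    · congr 1; linear_combination ((-1) * (φ x) * d + (2) * (ψ x) * c * d + (1) * (φ x) * c * d^2 + (-1) * (ψ x) * c^2 * d^2) * h2
  · refine key _ fun x => ?_
    simp only [pow_succ', pow_zero, mul_one, Module.End.mul_apply, step]
    congr 2
    · congr 1; linear_combination ((1) * (ψ x) * c + (-7) * (ψ x) * c^2 * d + (3) * (φ x) * c * d + (11) * (ψ x) * c^3 * d^2 + (-7) * (φ x) * c^2 * d^2 + (-6) * (ψ x) * c^4 * d^3 + (-1) * (φ x) * c^4 * d^4 + (1) * (ψ x) * c^5 * d^4 + (5) * (φ x) * c^3 * d^3) * h3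
    · congr 1; linear_combination ((-1) * (φ x) * d + (3) * (ψ x) * c * d + (4) * (φ x) * c * d^2 + (-7) * (ψ x) * c^2 * d^2 + (-4) * (φ x) * c^2 * d^3 + (5) * (ψ x) * c^3 * d^3 + (1) * (φ x) * c^3 * d^4 + (-1) * (ψ x) * c^4 * d^4) * h3
  · simp

/-- The action of the Weyl group on the coroot lattice. -/
def corootAct (A : GCM I) : A.Weyl →* Module.End ℤ (I → ℤ) :=
  A.cs.lift ⟨A.corootRefl, fun i j => by
    by_cases hij : i = j
    · subst hij
      have h : ∀ y, A.corootRefl i (A.corootRefl i y) = y := fun y => by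
        simp only [corootRefl, LinearMap.sub_apply, LinearMap.id_apply, LinearMap.smulRight_apply,
          map_sub, map_smul, Fintype.linearCombination_apply_single, A.diag, smul_eq_mul]
        module
      simpa [coxeterMatrix] using LinearMap.ext h
    · have h := refl_pow (Fintype.linearCombination ℤ fun k => A.a k i)
        (Fintype.linearCombination ℤ fun k => A.a k j) (Pi.single i (1 : ℤ)) (Pi.single j (1 : ℤ))
        (A.a j i) (A.a i j) (by simp [A.diag]) (by simp [A.diag]) (by simp) (by simp)
        (A.zero_iff (Ne.symm hij))
      simpa [coxeterMatrix, hij, corootRefl, mul_comm] using h⟩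

/-- The action of the Weyl group on the root lattice. -/
def rootAct (A : GCM I) : A.Weyl →* Module.End ℤ (I → ℤ) :=
  A.cs.lift ⟨A.rootRefl, fun i j => by
    by_cases hij : i = j
    · subst hij
      have h : ∀ y, A.rootRefl i (A.rootRefl i y) = y := fun y => by
        simp only [rootRefl, LinearMap.sub_apply, LinearMap.id_apply, LinearMap.smulRight_apply,
          map_sub, map_smul, Fintype.linearCombination_apply_single, A.diag, smul_eq_mul]
        module
      simpa [coxeterMatrix] using LinearMap.ext h
    · have h := refl_pow (Fintype.linearCombination ℤ fun k => A.a i k)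
        (Fintype.linearCombination ℤ fun k => A.a j k) (Pi.single i (1 : ℤ)) (Pi.single j (1 : ℤ))
        (A.a i j) (A.a j i) (by simp [A.diag]) (by simp [A.diag]) (by simp) (by simp)
        (A.zero_iff hij)
      simpa [coxeterMatrix, hij, rootRefl] using h⟩

/-- `w = v s_α` for the positive real root `α = u αᵢ`, where `s_α = u sᵢ u⁻¹`. -/
def IsReflStep (A : GCM I) (v w : A.Weyl) (ui : A.Weyl × I) : Prop :=
  0 ≤ A.rootAct ui.1 (Pi.single ui.2 1) ∧ w = v * (ui.1 * A.s ui.2 * ui.1⁻¹)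

/-- The cover relation `v ⋖ w` of the strong (Bruhat) order. -/
def StrongCover (A : GCM I) (v w : A.Weyl) : Prop :=
  (∃ ui, A.IsReflStep v w ui) ∧ A.len w = A.len v + 1

open Classical in
/-- The multiplicity `⟨α^∨, Λ⟩` of a strong cover `v ⋖ w = v s_α`, where `α = u αᵢ` is a positive
real root and `α^∨ = u αᵢ^∨`. The weight `Λ` is given by its values `⟨αᵢ^∨, Λ⟩`. -/
def strongMult (A : GCM I) (Λ : I → ℕ) (v w : A.Weyl) : ℕ :=
  if hvw : ∃ ui, A.IsReflStep v w ui then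
    (∑ k, A.corootAct hvw.choose.1 (Pi.single hvw.choose.2 1) k * (Λ k : ℤ)).toNat
  else 0

/-- The cover relation `v ≺ sᵢ v` of the left weak order. -/
def WeakCover (A : GCM I) (v w : A.Weyl) : Prop :=
  (∃ i, w = A.s i * v) ∧ A.len w = A.len v + 1

open Classical in
/-- The multiplicity `kᵢ` of a weak cover `v ≺ sᵢ v`, where `K = ∑ kᵢ αᵢ^∨`. -/
def weakMult (A : GCM I) (K : I → ℕ) (v w : A.Weyl) : ℕ :=
  if hvw : ∃ i, w = A.s i * v then K hvw.choose else 0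

theorem finite_len (A : GCM I) (n : ℕ) : {w : A.Weyl | A.len w = n}.Finite := by
  refine ((List.finite_length_eq I n).image A.cs.wordProd).subset ?_
  rintro w rfl
  obtain ⟨ω, hω, rfl⟩ := A.cs.exists_isReduced w
  exact ⟨ω, hω.eq.symm, rfl⟩

/-- The strong graph `Γ_s(Λ)`. A dominant integral weight `Λ` enters only through its values
`⟨αᵢ^∨, Λ⟩`, and is given by them; thus `Λᵢ` is `Pi.single i 1`. -/
def strongGraph (A : GCM I) (Λ : I → ℕ) : GradedGraph A.Weyl where
  Adj := A.StrongCover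
  h := A.len
  mult := A.strongMult Λ
  h_adj _ _ h := h.2
  finite_out v := (A.finite_len (A.len v + 1)).subset fun _ h => h.2
  finite_in w := (A.finite_len (A.len w - 1)).subset fun v h => by
    have := h.2
    change A.len v = A.len w - 1
    omega

/-- The weak graph `Γ_w(K)`, for `K = ∑ kᵢ αᵢ^∨`. -/
def weakGraph (A : GCM I) (K : I → ℕ) : GradedGraph A.Weyl where
  Adj := A.WeakCover
  h := A.len
  mult := A.weakMult K
  h_adj _ _ h := h.2
  finite_out v := (A.finite_len (A.len v + 1)).subset fun _ h => h.2
  finite_in w := (A.finite_len (A.len w - 1)).subset fun v h => by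
    have := h.2
    change A.len v = A.len w - 1
    omega

/-- `K = ∑ kᵢ αᵢ^∨` (with `kᵢ ≥ 0`) lies in the centre of `𝔤(A)`, that is, `⟨K, αⱼ⟩ = 0` for every
simple root `αⱼ`: the `kᵢ` are a linear dependence among the rows of `A`. -/
def IsCentral (A : GCM I) (K : I → ℕ) : Prop :=
  ∀ j, ∑ i, (K i : ℤ) * A.a i j = 0

/-- The natural off-diagonal part of a differential bijection for `(Γ_s(Λ), Γ_w(K))`: the path
`x → sᵢ x → sᵢ x s_α = y` goes to the path `x → x s_α → sᵢ x s_α = y` with the same markings.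
If `z = sᵢ x`, then `x s_α = sᵢ y = x z⁻¹ y`. -/
def IsNaturalOffDiag (A : GCM I) {Λ K : I → ℕ} {r : ℕ}
    (Φ : DifferentialBijection (A.strongGraph Λ) (A.weakGraph K) r) : Prop :=
  ∀ (x y : A.Weyl) (hxy : x ≠ y) (t : (A.strongGraph Λ).UD (A.weakGraph K) x y),
    (Φ.off x y hxy t).1 = (x * t.1.1⁻¹ * y, t.1.2.1, t.1.2.2)

end

end GCM

/-! ### Folding -/

section

variable {I J : Type*} [DecidableEq I] [DecidableEq J] [Fintype J]

/-- `π` is an admissible automorphism of `B`: distinct indices in the same `π`-orbit are not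
joined. -/
structure IsAdmissible (B : GCM J) (π : Equiv.Perm J) : Prop where
  aut : ∀ i j, B.a (π i) (π j) = B.a i j
  orbit : ∀ i j, i ≠ j → π.SameCycle i j → B.a i j = 0

/-- `A` is obtained from `(B, π)` by folding, where `p : J → I` indexes the `π`-orbits: the orbit
`Oᵢ` is the fibre of `p` over `i`. -/
structure IsFolding (A : GCM I) (B : GCM J) (π : Equiv.Perm J) (p : J → I) : Prop where
  surj : Function.Surjective p
  orbit : ∀ j k, p j = p k ↔ π.SameCycle j k
  entry : ∀ (i' i : I) (j' : J), p j' = i' →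
    (A.a i' i : ℚ) = ((Finset.univ.filter fun j => p j = i').card : ℚ) /
        ((Finset.univ.filter fun j => p j = i).card : ℚ) *
      ∑ j ∈ Finset.univ.filter (fun j => p j = i), (B.a j' j : ℚ)

/-- `φ(∑ kᵢ αᵢ^∨) = ∑ᵢ kᵢ ∑_{j ∈ Oᵢ} βⱼ^∨`, in coordinates. -/
def foldCoroot (p : J → I) (K : I → ℕ) : J → ℕ := fun j => K (p j)

/-- The condition `f(sᵢ) = ∏_{j ∈ Oᵢ} sⱼ` on a homomorphism of Weyl groups, for every order of the
factors. -/
def IsFoldHom (A : GCM I) (B : GCM J) (p : J → I) (f : A.Weyl →* B.Weyl) : Prop :=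
  ∀ (i : I) (l : List J), l.Nodup → (∀ j, j ∈ l ↔ p j = i) → f (A.s i) = (l.map B.s).prod

variable [Fintype I]

/-- A choice of identifications of the marked edges at `v` for a weak cover between `v` and `sᵢ v`
in the graphs for `A` with the marked edges at `f(v)` between `f(v)` and the `sⱼ f(v)`, `j ∈ Oᵢ`,
in the graphs for `B`.
For strong edges, the markings of `v → sᵢ v` (or of `sᵢ v → v`) correspond to the pairs of some
`j ∈ Oᵢ` and a marking of `f(v) → sⱼ f(v)` (or of `sⱼ f(v) → f(v)`). For weak edges, and every
`j ∈ Oᵢ`, the markings of `v → sᵢ v` correspond to those of `f(v) → sⱼ f(v)`, and similarly for the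
edges into `v` and `f(v)`. -/
structure FoldIdent (A : GCM I) (B : GCM J) (p : J → I) (f : A.Weyl →* B.Weyl)
    (K : I → ℕ) (i' : I) (j' : J) where
  /-- Strong edges out of `v`. -/
  strongOut : A.Weyl → I → ℕ → J × ℕ
  /-- Strong edges into `v`. -/
  strongIn : A.Weyl → I → ℕ → J × ℕ
  /-- Weak edges out of `v`. -/
  weakOut : A.Weyl → J → ℕ → ℕ
  /-- Weak edges into `v`. -/
  weakIn : A.Weyl → J → ℕ → ℕ
  strongOut_bij : ∀ v i, A.WeakCover v (A.s i * v) →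
    Set.BijOn (strongOut v i)
      (Set.Icc 1 (A.strongMult (Pi.single i' 1) v (A.s i * v)))
      {e | p e.1 = i ∧ e.2 ∈ Set.Icc 1 (B.strongMult (Pi.single j' 1) (f v) (B.s e.1 * f v))}
  strongIn_bij : ∀ v i, A.WeakCover (A.s i * v) v →
    Set.BijOn (strongIn v i)
      (Set.Icc 1 (A.strongMult (Pi.single i' 1) (A.s i * v) v))
      {e | p e.1 = i ∧ e.2 ∈ Set.Icc 1 (B.strongMult (Pi.single j' 1) (B.s e.1 * f v) (f v))}
  weakOut_bij : ∀ v j, A.WeakCover v (A.s (p j) * v) →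
    Set.BijOn (weakOut v j)
      (Set.Icc 1 (A.weakMult K v (A.s (p j) * v)))
      (Set.Icc 1 (B.weakMult (foldCoroot p K) (f v) (B.s j * f v)))
  weakIn_bij : ∀ v j, A.WeakCover (A.s (p j) * v) v →
    Set.BijOn (weakIn v j)
      (Set.Icc 1 (A.weakMult K (A.s (p j) * v) v))
      (Set.Icc 1 (B.weakMult (foldCoroot p K) (B.s j * f v) (f v)))

namespace FoldIdent

variable {A : GCM I} {B : GCM J} {p : J → I} {f : A.Weyl →* B.Weyl} {K : I → ℕ} {i' : I} {j' : J}

/-- The set `UD_v` for `A`. -/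
abbrev UDA (_ : FoldIdent A B p f K i' j') (v : A.Weyl) : Set (A.Weyl × ℕ × ℕ) :=
  (A.strongGraph (Pi.single i' 1)).UD (A.weakGraph K) v v

/-- The set `DU_v` for `A`. -/
abbrev DUA (_ : FoldIdent A B p f K i' j') (v : A.Weyl) : Set (A.Weyl × ℕ × ℕ) :=
  (A.strongGraph (Pi.single i' 1)).DU (A.weakGraph K) v v

/-- The set `UD_{f(v)}` for `B`. -/
abbrev UDB (_ : FoldIdent A B p f K i' j') (v : A.Weyl) : Set (B.Weyl × ℕ × ℕ) :=
  (B.strongGraph (Pi.single j' 1)).UD (B.weakGraph (foldCoroot p K)) (f v) (f v)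

/-- The set `DU_{f(v)}` for `B`. -/
abbrev DUB (_ : FoldIdent A B p f K i' j') (v : A.Weyl) : Set (B.Weyl × ℕ × ℕ) :=
  (B.strongGraph (Pi.single j' 1)).DU (B.weakGraph (foldCoroot p K)) (f v) (f v)

/-- The bijections `UD_v → UD_{f(v)}` are those given by the identifications of marked edges:
`(sᵢ v, m, m')` goes to `(sⱼ f(v), n, n')` if `m` corresponds to `(j, n)` and `m'` to `n'`. -/
def IsUDBij (ι : FoldIdent A B p f K i' j') (ud : ∀ v : A.Weyl, ι.UDA v ≃ ι.UDB v) : Prop :=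
  ∀ (v : A.Weyl) (t : ι.UDA v) (i : I), t.1.1 = A.s i * v →
    (ud v t).1 = (B.s (ι.strongIn v i t.1.2.1).1 * f v, (ι.strongIn v i t.1.2.1).2,
      ι.weakIn v (ι.strongIn v i t.1.2.1).1 t.1.2.2)

/-- The bijections `DU_v → DU_{f(v)}` are those given by the identifications of marked edges:
`(sᵢ v, M, M')` goes to `(sⱼ f(v), N, N')` if `M` corresponds to `(j, N)` and `M'` to `N'`. -/
def IsDUBij (ι : FoldIdent A B p f K i' j') (du : ∀ v : A.Weyl, ι.DUA v ≃ ι.DUB v) : Prop :=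
  ∀ (v : A.Weyl) (t : ι.DUA v) (i : I), t.1.1 = A.s i * v →
    (du v t).1 = (B.s (ι.strongOut v i t.1.2.1).1 * f v, (ι.strongOut v i t.1.2.1).2,
      ι.weakOut v (ι.strongOut v i t.1.2.1).1 t.1.2.2)

/-- `ΦA` is the restriction of `ΦB` under the bijections `ud`, `du`: its off-diagonal part is the
natural one, and its diagonal part at `v` is the diagonal part of `ΦB` at `f(v)`. -/
def IsRestriction (ι : FoldIdent A B p f K i' j') (ud : ∀ v : A.Weyl, ι.UDA v ≃ ι.UDB v)
    (du : ∀ v : A.Weyl, ι.DUA v ≃ ι.DUB v) {r : ℕ}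
    (ΦB : DifferentialBijection (B.strongGraph (Pi.single j' 1))
      (B.weakGraph (foldCoroot p K)) r)
    (ΦA : DifferentialBijection (A.strongGraph (Pi.single i' 1)) (A.weakGraph K) r) : Prop :=
  A.IsNaturalOffDiag ΦA ∧
    ∀ v, (ΦA.diag v).trans (du v) = ((Equiv.refl (Fin r)).sumCongr (ud v)).trans (ΦB.diag (f v))

end FoldIdent

end

end

section GeometricRepresentation

/-- Both coordinates of the alternating products of two reflections applied to the first simple
root; `c` and `d` are the negatives of the off-diagonal Cartan entries. -/
def dihedralCoord (c d : ℤ) : ℕ → ℤ × ℤ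
  | 0 => (1, 0)
  | m + 1 =>
    if Even m then ((dihedralCoord c d m).1, d * (dihedralCoord c d m).1 - (dihedralCoord c d m).2)
    else (c * (dihedralCoord c d m).2 - (dihedralCoord c d m).1, (dihedralCoord c d m).2)

theorem dihedralCoord_nonneg_of_four_le {c d : ℤ} (hc : 0 ≤ c) (hd : 0 ≤ d) (h : 4 ≤ c * d)
    (m : ℕ) : 0 ≤ dihedralCoord c d m := by
  suffices H : 0 ≤ (dihedralCoord c d m).1 ∧ 0 ≤ (dihedralCoord c d m).2 ∧
      (Even m → 2 * (dihedralCoord c d m).2 ≤ d * (dihedralCoord c d m).1) ∧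
      (¬ Even m → 2 * (dihedralCoord c d m).1 ≤ c * (dihedralCoord c d m).2) from ⟨H.1, H.2.1⟩
  induction m with
  | zero => simp [dihedralCoord, hd]
  | succ m ih =>
    obtain ⟨h1, h2, h3, h4⟩ := ih
    simp only [dihedralCoord]
    generalize (dihedralCoord c d m).1 = a at *
    generalize (dihedralCoord c d m).2 = b at *
    by_cases hm : Even m
    · simp only [hm, if_true, Nat.even_add_one, not_true, false_implies, not_false_iff, true_implies,
        true_and]
      have h3 := h3 hm
      refine ⟨h1, by linarith, ?_⟩
      have := mul_le_mul_of_nonneg_left h3 hc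
      nlinarith
    · simp only [hm, if_false, Nat.even_add_one, not_false_iff, true_implies, not_true,
        false_implies, and_true]
      have h4 := h4 hm
      refine ⟨by linarith, h2, ?_⟩
      have := mul_le_mul_of_nonneg_left h4 hd
      nlinarith

theorem dihedralCoord_nonneg {c d : ℤ} (hc : 0 ≤ c) (hd : 0 ≤ d) (hcd : c = 0 ↔ d = 0) (m : ℕ)
    (hm : GCM.coxeterEntry (c * d) ≠ 0 → m < GCM.coxeterEntry (c * d)) :
    0 ≤ dihedralCoord c d m := by
  by_cases h4 : 4 ≤ c * d
  · exact dihedralCoord_nonneg_of_four_le hc hd h4 m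
  have h0 : 0 ≤ c * d := mul_nonneg hc hd
  have key : (c = 0 ∧ d = 0) ∨ (c ≤ 3 ∧ d ≤ 3 ∧ 1 ≤ c ∧ 1 ≤ d) := by
    rcases hc.eq_or_lt with h | h
    · exact Or.inl ⟨h.symm, hcd.1 h.symm⟩
    · have hd' : 0 < d := lt_of_le_of_ne hd fun h' => h.ne' (hcd.2 h'.symm)
      right
      refine ⟨?_, ?_, by omega, by omega⟩ <;> nlinarith
  rcases key with ⟨rfl, rfl⟩ | ⟨h1, h2, h3, h5⟩
  · have : m < 2 := by simpa [GCM.coxeterEntry] using hm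
    interval_cases m <;> decide
  · have hm' : m < 6 := by
      have h1 : 1 ≤ c * d := by nlinarith
      have : c * d = 1 ∨ c * d = 2 ∨ c * d = 3 := by omega
      rcases this with h | h | h <;> simp [GCM.coxeterEntry, h] at hm <;> omega
    revert hm
    interval_cases c <;> interval_cases d <;> first | omega | (interval_cases m <;> decide)

theorem CoxeterSystem.exists_eq_mul_alternatingWord {I W : Type*} [Group W] {M : CoxeterMatrix I}
    (cs : CoxeterSystem M W) (n : ℕ) : ∀ (w : W) (i j : I), cs.length w = n → cs.IsRightDescent w j →
      ∃ (v : W) (m : ℕ), w = v * cs.wordProd (alternatingWord i j (m + 1)) ∧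
        cs.length w = cs.length v + (m + 1) ∧ ¬ cs.IsRightDescent v i ∧ ¬ cs.IsRightDescent v j := by
  induction n with
  | zero =>
    intro w i j hn hw
    simp [CoxeterSystem.IsRightDescent, hn] at hw
  | succ n ih =>
    intro w i j hn hw
    have hl := cs.isRightDescent_iff.1 hw
    have hj : ¬ cs.IsRightDescent (w * cs.simple j) j :=
      cs.isRightDescent_iff_not_isRightDescent_mul.1 hw
    by_cases hi : cs.IsRightDescent (w * cs.simple j) i
    · obtain ⟨v, m, hv, hlen, h1, h2⟩ := ih (w * cs.simple j) j i (by omega) hi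
      refine ⟨v, m + 1, ?_, by omega, h2, h1⟩
      rw [alternatingWord_succ, cs.wordProd_concat, ← mul_assoc, ← hv,
        cs.simple_mul_simple_cancel_right]
    · refine ⟨w * cs.simple j, 0, ?_, by omega, hi, hj⟩
      simp [alternatingWord]

variable {I W : Type*} [DecidableEq I] [Fintype I] [Group W]

/-- `ρ` is the geometric representation of the Coxeter group `W` defined by the generalized Cartan
matrix `C`. -/
structure IsGeometricRep {M : CoxeterMatrix I} (C : GCM I) (cs : CoxeterSystem M W)
    (ρ : W →* Module.End ℤ (I → ℤ)) : Prop where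
  matrix_eq : M = C.coxeterMatrix
  simple_apply : ∀ i x,
    ρ (cs.simple i) x = x - (∑ k, C.a i k * x k) • (Pi.single i 1 : I → ℤ)

namespace IsGeometricRep

variable {M : CoxeterMatrix I} {C : GCM I} {cs : CoxeterSystem M W} {ρ : W →* Module.End ℤ (I → ℤ)}

theorem simple_apply_single (h : IsGeometricRep C cs ρ) (i j : I) :
    ρ (cs.simple i) (Pi.single j 1) = Pi.single j 1 - C.a i j • (Pi.single i 1 : I → ℤ) := by
  rw [h.simple_apply]
  simp [Pi.single_apply]

theorem simple_apply_self (h : IsGeometricRep C cs ρ) (i : I) :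
    ρ (cs.simple i) (Pi.single i 1) = -(Pi.single i 1 : I → ℤ) := by
  rw [h.simple_apply_single, C.diag]
  module

theorem mul_simple_apply_self (h : IsGeometricRep C cs ρ) (w : W) (i : I) :
    ρ (w * cs.simple i) (Pi.single i 1) = -ρ w (Pi.single i 1 : I → ℤ) := by
  rw [map_mul, Module.End.mul_apply, h.simple_apply_self, map_neg]

theorem simple_apply_of_ne (h : IsGeometricRep C cs ρ) {i k : I} (hik : k ≠ i) (x : I → ℤ) :
    ρ (cs.simple i) x k = x k := by
  rw [h.simple_apply]
  simp [hik]

theorem inv_apply_apply (_ : IsGeometricRep C cs ρ) (w : W) (x : I → ℤ) : ρ w⁻¹ (ρ w x) = x := by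
  rw [← Module.End.mul_apply, ← map_mul, inv_mul_cancel, map_one, Module.End.one_apply]

theorem apply_inv_apply (_ : IsGeometricRep C cs ρ) (w : W) (x : I → ℤ) : ρ w (ρ w⁻¹ x) = x := by
  rw [← Module.End.mul_apply, ← map_mul, mul_inv_cancel, map_one, Module.End.one_apply]

theorem alternatingWord_apply (h : IsGeometricRep C cs ρ) (i j : I) (m : ℕ) :
    ρ (cs.wordProd (CoxeterSystem.alternatingWord i j m)) (Pi.single i 1) =
      (dihedralCoord (-C.a i j) (-C.a j i) m).1 • (Pi.single i 1 : I → ℤ) +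
      (dihedralCoord (-C.a i j) (-C.a j i) m).2 • (Pi.single j 1 : I → ℤ) := by
  induction m with
  | zero => simp [CoxeterSystem.alternatingWord, dihedralCoord]
  | succ m ih =>
    rw [CoxeterSystem.alternatingWord_succ', cs.wordProd_cons, map_mul, Module.End.mul_apply, ih,
      map_add, map_smul, map_smul]
    simp only [dihedralCoord]
    split_ifs with hm
    · rw [h.simple_apply_single, h.simple_apply_self]
      module
    · rw [h.simple_apply_self, h.simple_apply_single]
      module

theorem nonneg_of_not_isRightDescent (h : IsGeometricRep C cs ρ) (w : W) (i : I)
    (hw : ¬ cs.IsRightDescent w i) : 0 ≤ ρ w (Pi.single i 1) := by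
  induction hn : cs.length w using Nat.strong_induction_on generalizing w i with
  | _ n ih =>
  by_cases h1 : w = 1
  · subst h1
    rw [map_one, Module.End.one_apply]
    exact Pi.single_nonneg.2 zero_le_one
  obtain ⟨j, hj⟩ := cs.exists_rightDescent_of_ne_one h1
  have hij : i ≠ j := by
    rintro rfl
    exact hw hj
  obtain ⟨v, m, hv, hlen, hvi, hvj⟩ := cs.exists_eq_mul_alternatingWord _ w i j rfl hj
  have hcoord : 0 ≤ dihedralCoord (-C.a i j) (-C.a j i) (m + 1) := by
    refine dihedralCoord_nonneg (by have := C.nonpos i j hij; omega)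
      (by have := C.nonpos j i hij.symm; omega) ?_ _ ?_
    · rw [neg_eq_zero, neg_eq_zero]
      exact C.zero_iff hij
    · intro hM
      by_contra hcon
      have hMij : M j i = GCM.coxeterEntry (-C.a i j * -C.a j i) := by
        rw [h.matrix_eq]
        change (if j = i then 1 else _) = _
        rw [if_neg hij.symm]
        congr 1
        ring
      rw [← hMij] at hM hcon
      have hred := cs.not_isReduced_alternatingWord j i (m := m + 1 + 1) hM (by omega)
      apply hred
      have h1 := cs.length_wordProd_le (CoxeterSystem.alternatingWord j i (m + 1 + 1))
      rw [CoxeterSystem.length_alternatingWord] at h1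
      have h2 := cs.not_isRightDescent_iff.1 hw
      have h3 : w * cs.simple i =
          v * cs.wordProd (CoxeterSystem.alternatingWord j i (m + 1 + 1)) := by
        rw [CoxeterSystem.alternatingWord_succ, cs.wordProd_concat, ← mul_assoc, ← hv]
      have h4 := cs.length_mul_le v (cs.wordProd (CoxeterSystem.alternatingWord j i (m + 1 + 1)))
      rw [← h3] at h4
      rw [CoxeterSystem.IsReduced, CoxeterSystem.length_alternatingWord]
      omega
  rw [hv, map_mul, Module.End.mul_apply, h.alternatingWord_apply i j, map_add, map_smul, map_smul]
  have e1 := ih _ (by omega) v i hvi rfl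
  have e2 := ih _ (by omega) v j hvj rfl
  exact add_nonneg (smul_nonneg hcoord.1 e1) (smul_nonneg hcoord.2 e2)

theorem nonpos_of_isRightDescent (h : IsGeometricRep C cs ρ) (w : W) (i : I)
    (hw : cs.IsRightDescent w i) : ρ w (Pi.single i 1) ≤ 0 := by
  have := h.nonneg_of_not_isRightDescent (w * cs.simple i) i
    (cs.isRightDescent_iff_not_isRightDescent_mul.1 hw)
  rw [h.mul_simple_apply_self] at this
  simpa using this

theorem apply_single_ne_zero (h : IsGeometricRep C cs ρ) (w : W) (i : I) :
    ρ w (Pi.single i 1) ≠ 0 := by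
  intro h0
  have := h.inv_apply_apply w (Pi.single i 1)
  rw [h0, map_zero] at this
  have := congrFun this i
  simp at this

theorem nonneg_iff (h : IsGeometricRep C cs ρ) (w : W) (i : I) :
    0 ≤ ρ w (Pi.single i 1) ↔ ¬ cs.IsRightDescent w i :=
  ⟨fun h0 hw => h.apply_single_ne_zero w i (le_antisymm (h.nonpos_of_isRightDescent w i hw) h0),
    h.nonneg_of_not_isRightDescent w i⟩

theorem nonpos_iff (h : IsGeometricRep C cs ρ) (w : W) (i : I) :
    ρ w (Pi.single i 1) ≤ 0 ↔ cs.IsRightDescent w i :=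
  ⟨fun h0 => by
    by_contra hw
    exact h.apply_single_ne_zero w i (le_antisymm h0 (h.nonneg_of_not_isRightDescent w i hw)),
    h.nonpos_of_isRightDescent w i⟩

theorem nonneg_or_nonpos (h : IsGeometricRep C cs ρ) (w : W) (i : I) :
    0 ≤ ρ w (Pi.single i 1) ∨ ρ w (Pi.single i 1) ≤ 0 := by
  rw [h.nonneg_iff, h.nonpos_iff]
  tauto

theorem eq_one_of_nonneg (h : IsGeometricRep C cs ρ) {w : W}
    (hw : ∀ i, 0 ≤ ρ w (Pi.single i 1)) : w = 1 := by
  by_contra h1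
  obtain ⟨i, hi⟩ := cs.exists_rightDescent_of_ne_one h1
  exact (h.nonneg_iff w i).1 (hw i) hi

theorem injective (h : IsGeometricRep C cs ρ) : Function.Injective ρ := by
  rw [injective_iff_map_eq_one]
  intro w hw
  refine h.eq_one_of_nonneg fun i => ?_
  rw [hw, Module.End.one_apply]
  exact Pi.single_nonneg.2 zero_le_one

theorem eq_one_or_neg_one (h : IsGeometricRep C cs ρ) {u : W} {i : I} {c : ℤ} {x : I → ℤ}
    (hu : ρ u (Pi.single i 1) = c • x) : c = 1 ∨ c = -1 := by
  have h1 := h.inv_apply_apply u (Pi.single i 1)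
  rw [hu, map_smul] at h1
  have h2 := congrFun h1 i
  rw [Pi.smul_apply, Pi.single_eq_same, smul_eq_mul] at h2
  exact Int.eq_one_or_neg_one_of_mul_eq_one h2

theorem eq_single_of_simple_apply_nonpos (h : IsGeometricRep C cs ρ) {u : W} {i j : I}
    (h0 : 0 ≤ ρ u (Pi.single j 1)) (h1 : ρ (cs.simple i * u) (Pi.single j 1) ≤ 0) :
    ρ u (Pi.single j 1) = Pi.single i 1 := by
  have key : ρ u (Pi.single j 1) = (ρ u (Pi.single j 1) i) • (Pi.single i 1 : I → ℤ) := by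
    ext k
    by_cases hk : k = i
    · subst hk
      simp
    · rw [map_mul, Module.End.mul_apply] at h1
      have h2 := h1 k
      rw [h.simple_apply_of_ne hk] at h2
      have h3 := h0 k
      simp only [Pi.zero_apply] at h2 h3
      simp only [Pi.smul_apply, Pi.single_apply, if_neg hk, smul_zero]
      omega
  have h2 := h0 i
  rcases h.eq_one_or_neg_one key with h3 | h3
  · rw [key, h3, one_smul]
  · rw [h3] at h2
    simp at h2

theorem conj_eq_of_apply_eq (h : IsGeometricRep C cs ρ) {u : W} {i j : I}
    (hu : ρ u (Pi.single j 1) = Pi.single i 1) : u * cs.simple j * u⁻¹ = cs.simple i := by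
  have key : cs.simple i * (u * cs.simple j * u⁻¹) = 1 := by
    have hinv : ρ u⁻¹ (Pi.single i 1) = Pi.single j 1 := by rw [← hu, h.inv_apply_apply]
    refine h.eq_one_of_nonneg fun k => ?_
    by_cases hk : k = i
    · subst hk
      rw [map_mul, map_mul, map_mul, Module.End.mul_apply, Module.End.mul_apply,
        Module.End.mul_apply, hinv, h.simple_apply_self, map_neg, hu, map_neg, h.simple_apply_self,
        neg_neg]
      exact Pi.single_nonneg.2 zero_le_one
    · refine (h.nonneg_or_nonpos _ k).resolve_right fun hneg => ?_
      have h1 := hneg k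
      rw [map_mul, Module.End.mul_apply, h.simple_apply_of_ne hk, map_mul, map_mul,
        Module.End.mul_apply, Module.End.mul_apply, h.simple_apply, map_sub, map_smul, hu,
        h.apply_inv_apply] at h1
      simp [hk] at h1
  rw [mul_eq_one_iff_inv_eq, cs.inv_simple] at key
  exact key.symm

theorem length_mul_reflection_lt (h : IsGeometricRep C cs ρ) {u : W} {j : I}
    (hu : 0 ≤ ρ u (Pi.single j 1)) (w : W) (hw : ρ (w * u) (Pi.single j 1) ≤ 0) :
    cs.length (w * (u * cs.simple j * u⁻¹)) < cs.length w := by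
  induction hn : cs.length w using Nat.strong_induction_on generalizing w with
  | _ n ih =>
  by_cases h1 : w = 1
  · subst h1
    rw [one_mul] at hw
    exact absurd (le_antisymm hw hu) (h.apply_single_ne_zero u j)
  obtain ⟨i, hi⟩ := cs.exists_leftDescent_of_ne_one h1
  have hlen := cs.isLeftDescent_iff.1 hi
  have hw' : w = cs.simple i * (cs.simple i * w) := by rw [cs.simple_mul_simple_cancel_left]
  rcases h.nonneg_or_nonpos (cs.simple i * w * u) j with h2 | h2
  · have h3 : ρ (cs.simple i * (cs.simple i * w * u)) (Pi.single j 1) ≤ 0 := by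
      rwa [mul_assoc (cs.simple i) w u, cs.simple_mul_simple_cancel_left]
    have h4 := h.conj_eq_of_apply_eq (h.eq_single_of_simple_apply_nonpos h2 h3)
    have h5 : w * (u * cs.simple j * u⁻¹) = cs.simple i * w := by
      have : u * cs.simple j * u⁻¹ = (cs.simple i * w)⁻¹ * cs.simple i * (cs.simple i * w) := by
        generalize cs.simple i * w = g at h4 ⊢
        rw [← h4]
        group
      rw [this]
      simp [mul_assoc]
    rw [h5]
    omega
  · have h3 := ih _ (by omega) (cs.simple i * w) h2 rfl
    rw [hw', mul_assoc (cs.simple i)]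
    rcases cs.length_simple_mul (cs.simple i * w * (u * cs.simple j * u⁻¹)) i with h4 | h4 <;> omega

theorem length_lt_mul_reflection_iff (h : IsGeometricRep C cs ρ) {u : W} {j : I}
    (hu : 0 ≤ ρ u (Pi.single j 1)) (w : W) :
    cs.length w < cs.length (w * (u * cs.simple j * u⁻¹)) ↔ 0 ≤ ρ (w * u) (Pi.single j 1) := by
  constructor
  · intro h1
    refine (h.nonneg_or_nonpos _ _).resolve_right fun h2 => ?_
    have := h.length_mul_reflection_lt hu w h2
    omega
  · intro h1
    have h2 : ρ (w * (u * cs.simple j * u⁻¹) * u) (Pi.single j 1) ≤ 0 := by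
      have : w * (u * cs.simple j * u⁻¹) * u = w * u * cs.simple j := by group
      rw [this, h.mul_simple_apply_self]
      simpa using h1
    have := h.length_mul_reflection_lt hu _ h2
    have h3 : w * (u * cs.simple j * u⁻¹) * (u * cs.simple j * u⁻¹) = w := by
      simp [mul_assoc]
    rwa [h3] at this

theorem apply_eq_or_eq_neg_of_conj_eq (h : IsGeometricRep C cs ρ) {u v : W} {i j : I}
    (huv : u * cs.simple i * u⁻¹ = v * cs.simple j * v⁻¹) :
    ρ u (Pi.single i 1) = ρ v (Pi.single j 1) ∨ ρ u (Pi.single i 1) = -ρ v (Pi.single j 1) := by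
  have h1 : v⁻¹ * u * cs.simple i = cs.simple j * (v⁻¹ * u) := by
    have : v⁻¹ * (u * cs.simple i * u⁻¹) * u = v⁻¹ * (v * cs.simple j * v⁻¹) * u := by rw [huv]
    simpa [mul_assoc] using this
  have h2 := congrArg (fun g => ρ g (Pi.single i 1)) h1
  simp only [h.mul_simple_apply_self] at h2
  rw [map_mul ρ (cs.simple j), Module.End.mul_apply, h.simple_apply] at h2
  set x := ρ (v⁻¹ * u) (Pi.single i 1) with hx
  set c := ∑ k, C.a j k * x k
  have h3 : x = x j • (Pi.single j 1 : I → ℤ) := by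
    ext k
    by_cases hk : k = j
    · subst hk
      simp
    · have := congrFun h2 k
      simp [hk] at this ⊢
      omega
  have h4 : ρ u (Pi.single i 1) = ρ v x := by
    rw [hx, ← Module.End.mul_apply, ← map_mul, mul_inv_cancel_left]
  rcases h.eq_one_or_neg_one h3 with h5 | h5
  · left
    rw [h4, h3, h5, one_smul]
  · right
    rw [h4, h3, h5, neg_one_smul, map_neg]

theorem simple_injective (h : IsGeometricRep C cs ρ) : Function.Injective cs.simple := by
  intro i j hij
  have h1 := h.simple_apply_self i
  rw [hij, h.simple_apply] at h1
  by_contra hne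
  have := congrFun h1 i
  simp [Pi.single_apply, hne] at this

end IsGeometricRep

end GeometricRepresentation

section WeylGraphs

namespace GCM

variable {I : Type*}

/-- The transposed generalized Cartan matrix. -/
def transpose (A : GCM I) : GCM I where
  a := A.a.transpose
  diag := A.diag
  nonpos i j h := A.nonpos j i h.symm
  neg_iff i j h := A.neg_iff j i h.symm

variable [DecidableEq I]

theorem coxeterMatrix_transpose (A : GCM I) : A.transpose.coxeterMatrix = A.coxeterMatrix := by
  ext i j
  simp [coxeterMatrix, transpose, mul_comm]

variable [Fintype I] (A : GCM I)

theorem isGeometricRep_rootAct : IsGeometricRep A A.cs A.rootAct where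
  matrix_eq := rfl
  simple_apply i x := by
    have h : A.rootAct (A.s i) = A.rootRefl i := A.cs.lift_apply_simple _ i
    rw [h]
    simp [rootRefl, Fintype.linearCombination_apply, mul_comm]

theorem isGeometricRep_corootAct : IsGeometricRep A.transpose A.cs A.corootAct where
  matrix_eq := A.coxeterMatrix_transpose.symm
  simple_apply i x := by
    have h : A.corootAct (A.s i) = A.corootRefl i := A.cs.lift_apply_simple _ i
    rw [h]
    simp [corootRefl, Fintype.linearCombination_apply, mul_comm, transpose]

theorem rootAct_nonneg_iff_corootAct_nonneg (w : A.Weyl) (i : I) :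
    0 ≤ A.rootAct w (Pi.single i 1) ↔ 0 ≤ A.corootAct w (Pi.single i 1) := by
  rw [A.isGeometricRep_rootAct.nonneg_iff, A.isGeometricRep_corootAct.nonneg_iff]

theorem corootAct_inv_nonneg_iff (w : A.Weyl) (i : I) :
    0 ≤ A.corootAct w⁻¹ (Pi.single i 1) ↔ A.len (A.s i * w) = A.len w + 1 := by
  rw [A.isGeometricRep_corootAct.nonneg_iff, A.cs.isRightDescent_inv_iff,
    A.cs.not_isLeftDescent_iff]

theorem corootAct_eq_of_conj_eq {u v : A.Weyl} {i j : I}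
    (hu : 0 ≤ A.rootAct u (Pi.single i 1)) (hv : 0 ≤ A.rootAct v (Pi.single j 1))
    (h : u * A.s i * u⁻¹ = v * A.s j * v⁻¹) :
    A.corootAct u (Pi.single i 1) = A.corootAct v (Pi.single j 1) := by
  rw [rootAct_nonneg_iff_corootAct_nonneg] at hu hv
  refine (A.isGeometricRep_corootAct.apply_eq_or_eq_neg_of_conj_eq h).resolve_right fun h1 => ?_
  rw [h1] at hu
  exact A.isGeometricRep_corootAct.apply_single_ne_zero v j (le_antisymm (by simpa using hu) hv)

/-- The value `⟨w αᵢ^∨, Λ⟩`. -/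
def corootPairing (Λ : I → ℕ) (w : A.Weyl) (i : I) : ℤ :=
  ∑ k, A.corootAct w (Pi.single i 1) k * (Λ k : ℤ)

variable {A}

theorem corootPairing_nonneg (Λ : I → ℕ) {w : A.Weyl} {i : I}
    (h : 0 ≤ A.corootAct w (Pi.single i 1)) : 0 ≤ A.corootPairing Λ w i :=
  Finset.sum_nonneg fun k _ => mul_nonneg (h k) (Int.natCast_nonneg _)

theorem IsReflStep.strongMult_eq {v w : A.Weyl} {ui : A.Weyl × I} (h : A.IsReflStep v w ui)
    (Λ : I → ℕ) : (A.strongMult Λ v w : ℤ) = A.corootPairing Λ ui.1 ui.2 := by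
  have hex : ∃ ui, A.IsReflStep v w ui := ⟨ui, h⟩
  rw [strongMult, dif_pos hex, A.corootAct_eq_of_conj_eq hex.choose_spec.1 h.1
    (mul_left_cancel (hex.choose_spec.2.symm.trans h.2))]
  exact Int.toNat_of_nonneg
    (corootPairing_nonneg Λ ((A.rootAct_nonneg_iff_corootAct_nonneg _ _).1 h.1))

theorem isReflStep_simple_mul {v : A.Weyl} {i : I} (h : A.len (A.s i * v) = A.len v + 1) :
    A.IsReflStep v (A.s i * v) (v⁻¹, i) :=
  ⟨(A.rootAct_nonneg_iff_corootAct_nonneg _ _).2 ((A.corootAct_inv_nonneg_iff v i).2 h),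
    by simp [mul_assoc]⟩

theorem WeakCover.strongCover {v w : A.Weyl} (h : A.WeakCover v w) : A.StrongCover v w := by
  obtain ⟨⟨i, rfl⟩, h⟩ := h
  exact ⟨⟨_, isReflStep_simple_mul h⟩, h⟩

theorem strongMult_simple_mul (Λ : I → ℕ) {v : A.Weyl} {i : I}
    (h : A.len (A.s i * v) = A.len v + 1) :
    (A.strongMult Λ v (A.s i * v) : ℤ) = A.corootPairing Λ v⁻¹ i :=
  (isReflStep_simple_mul h).strongMult_eq Λ

theorem corootPairing_inv_simple_mul (Λ : I → ℕ) (v : A.Weyl) (i : I) :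
    A.corootPairing Λ (A.s i * v)⁻¹ i = -A.corootPairing Λ v⁻¹ i := by
  simp only [corootPairing, mul_inv_rev, A.cs.inv_simple]
  rw [A.isGeometricRep_corootAct.mul_simple_apply_self]
  simp

theorem simple_injective : Function.Injective A.s := A.isGeometricRep_rootAct.simple_injective

theorem weakMult_simple_mul (K : I → ℕ) (v : A.Weyl) (i : I) :
    A.weakMult K v (A.s i * v) = K i := by
  have hex : ∃ k, A.s i * v = A.s k * v := ⟨i, rfl⟩
  rw [weakMult, dif_pos hex, ← simple_injective (mul_right_cancel hex.choose_spec)]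

theorem strongMult_congr (Λ : I → ℕ) {v w v' w' : A.Weyl} (h : v⁻¹ * w = v'⁻¹ * w') :
    A.strongMult Λ v w = A.strongMult Λ v' w' := by
  have key : A.IsReflStep v w = A.IsReflStep v' w' := by
    ext ui
    refine and_congr_right fun _ => ?_
    rw [← inv_mul_eq_iff_eq_mul, h, inv_mul_eq_iff_eq_mul]
  unfold strongMult
  rw [key]

theorem eq_simple_mul_of_length_lt {x t : A.Weyl} {ui : A.Weyl × I} {i : I}
    (hu : A.IsReflStep x (x * t) ui) (h1 : A.len x < A.len (x * t))
    (h2 : ¬ A.len (A.s i * x) < A.len (A.s i * x * t)) : x * t = A.s i * x := by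
  have ht := mul_left_cancel hu.2
  have hg := A.isGeometricRep_rootAct
  rw [ht] at h1 h2 ⊢
  have h3 := (hg.length_lt_mul_reflection_iff hu.1 x).1 h1
  have h4 := (hg.nonneg_or_nonpos _ _).resolve_left
    (mt (hg.length_lt_mul_reflection_iff hu.1 (A.s i * x)).2 h2)
  rw [mul_assoc (A.s i) x] at h4
  have h5 := hg.conj_eq_of_apply_eq (hg.eq_single_of_simple_apply_nonpos h3 h4)
  change _ = A.cs.simple i * x
  rw [← h5]
  group

theorem StrongCover.natural {x y z : A.Weyl} (hxy : x ≠ y) (hs : A.StrongCover z y)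
    (hw : A.WeakCover z x) :
    A.StrongCover x (x * z⁻¹ * y) ∧ A.WeakCover y (x * z⁻¹ * y) := by
  obtain ⟨⟨ui, hui⟩, hlen⟩ := hs
  obtain ⟨⟨i, rfl⟩, hlen'⟩ := hw
  obtain ⟨t, rfl⟩ : ∃ t, y = z * t := ⟨z⁻¹ * y, by simp⟩
  have e : A.s i * z * z⁻¹ * (z * t) = A.s i * z * t := by group
  rw [e]
  have h1 : A.len (A.s i * z) < A.len (A.s i * z * t) := by
    by_contra h2
    exact hxy (eq_simple_mul_of_length_lt hui (by omega) h2).symm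
  have h2 := A.cs.length_simple_mul (z * t) i
  rw [← mul_assoc] at h2
  have h3 : A.len (A.s i * z * t) = A.len (z * t) + 1 := by
    simp only [GCM.len, GCM.s] at *
    omega
  refine ⟨⟨⟨ui, hui.1, ?_⟩, by omega⟩, ⟨i, by rw [mul_assoc]⟩, h3⟩
  rw [← mul_left_cancel hui.2]

theorem StrongCover.natural_symm {x y w : A.Weyl} (hxy : x ≠ y) (hs : A.StrongCover x w)
    (hw : A.WeakCover y w) :
    A.StrongCover (y * w⁻¹ * x) y ∧ A.WeakCover (y * w⁻¹ * x) x := by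
  obtain ⟨⟨ui, hui⟩, hlen⟩ := hs
  obtain ⟨⟨i, rfl⟩, hlen'⟩ := hw
  obtain ⟨t, ht⟩ : ∃ t, A.s i * y = x * t := ⟨x⁻¹ * (A.s i * y), by simp⟩
  have e : y * (A.s i * y)⁻¹ * x = A.s i * x := by
    rw [mul_inv_rev, A.cs.inv_simple]
    group
  have hy : y = A.s i * x * t := by
    rw [mul_assoc, ← ht, A.cs.simple_mul_simple_cancel_left]
  rw [e]
  have h1 : A.len (A.s i * x) < A.len y := by
    by_contra h2
    rw [ht] at hui hlen
    rw [hy] at h2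
    have h3 := eq_simple_mul_of_length_lt hui (by omega) h2
    rw [← ht] at h3
    exact hxy (mul_left_cancel h3).symm
  have h2 := A.cs.length_simple_mul x i
  have h3 : A.len (A.s i * x) + 1 = A.len x := by
    simp only [GCM.len, GCM.s] at *
    omega
  refine ⟨⟨⟨ui, hui.1, ?_⟩, by omega⟩, ⟨i, ?_⟩, by omega⟩
  · rw [ht] at hui
    rw [← mul_left_cancel hui.2]
    exact hy
  · rw [A.cs.simple_mul_simple_cancel_left]

theorem WeakCover.weakMult_eq {x y z w : A.Weyl} (K : I → ℕ) (h : A.WeakCover z x)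
    (he : w = x * z⁻¹ * y) : A.weakMult K z x = A.weakMult K y w := by
  obtain ⟨⟨i, rfl⟩, -⟩ := h
  have : w = A.s i * y := by
    rw [he]
    group
  rw [this, weakMult_simple_mul, weakMult_simple_mul]

variable (A)

/-- The natural bijection between the marked paths from `x` down to `z = sᵢ x` in the weak graph
and up to `y = z s_α` in the strong graph, and the marked paths from `x` up to `x s_α` and down
to `y`. -/
def naturalOffDiag (Λ K : I → ℕ) (x y : A.Weyl) (hxy : x ≠ y) :
    (A.strongGraph Λ).UD (A.weakGraph K) x y ≃ (A.strongGraph Λ).DU (A.weakGraph K) x y where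
  toFun t := ⟨(x * t.1.1⁻¹ * y, t.1.2.1, t.1.2.2), by
    obtain ⟨⟨z, m, m'⟩, h1, h2, h3, h4⟩ := t
    obtain ⟨h5, h6⟩ := StrongCover.natural hxy h1 h2
    refine ⟨h5, h6, ?_, ?_⟩
    · change m ∈ Set.Icc 1 (A.strongMult Λ x (x * z⁻¹ * y))
      rwa [strongMult_congr Λ (v' := z) (w' := y) (by group)]
    · change m' ∈ Set.Icc 1 (A.weakMult K y (x * z⁻¹ * y))
      rwa [← WeakCover.weakMult_eq K h2 rfl]⟩
  invFun t := ⟨(y * t.1.1⁻¹ * x, t.1.2.1, t.1.2.2), by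
    obtain ⟨⟨w, m, m'⟩, h1, h2, h3, h4⟩ := t
    obtain ⟨h5, h6⟩ := StrongCover.natural_symm hxy h1 h2
    refine ⟨h5, h6, ?_, ?_⟩
    · change m ∈ Set.Icc 1 (A.strongMult Λ (y * w⁻¹ * x) y)
      rwa [strongMult_congr Λ (v' := x) (w' := w) (by group)]
    · change m' ∈ Set.Icc 1 (A.weakMult K (y * w⁻¹ * x) x)
      rwa [WeakCover.weakMult_eq K h6 (w := w) (y := y) (by group)]⟩
  left_inv t := by
    ext
    · simp [mul_assoc]
    · rfl
    · rfl
  right_inv t := by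
    ext
    · simp [mul_assoc]
    · rfl
    · rfl

variable {A}

theorem corootAct_central {K : I → ℕ} (hK : A.IsCentral K) (w : A.Weyl) :
    A.corootAct w (fun i => (K i : ℤ)) = fun i => (K i : ℤ) := by
  induction w using A.cs.simple_induction with
  | simple i =>
    rw [A.isGeometricRep_corootAct.simple_apply]
    have := hK i
    simp only [transpose, Matrix.transpose_apply]
    simp_rw [mul_comm (A.a _ i), this, zero_smul, sub_zero]
  | one => simp
  | mul v w hv hw => rw [map_mul, Module.End.mul_apply, hw, hv]

theorem sum_mul_corootPairing {K : I → ℕ} (hK : A.IsCentral K) (Λ : I → ℕ) (w : A.Weyl) :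
    ∑ i, (K i : ℤ) * A.corootPairing Λ w i = ∑ i, (K i : ℤ) * (Λ i : ℤ) := by
  have h := corootAct_central hK w
  have hsum : (fun i => (K i : ℤ)) = ∑ i, (K i : ℤ) • (Pi.single i 1 : I → ℤ) := by
    ext k
    simp [Finset.sum_apply, Pi.single_apply]
  nth_rewrite 1 [hsum] at h
  rw [map_sum] at h
  simp only [corootPairing, Finset.mul_sum]
  rw [Finset.sum_comm]
  refine Finset.sum_congr rfl fun k _ => ?_
  have hk := congrFun h k
  simp only [Finset.sum_apply, map_smul, Pi.smul_apply, smul_eq_mul] at hk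
  rw [← hk, Finset.sum_mul]
  exact Finset.sum_congr rfl fun i _ => by ring

end GCM

end WeylGraphs

section Duality

namespace GradedGraph

variable {V : Type*} (Γ Γ' : GradedGraph V)

open Classical in
theorem up_single_apply (x y : V) :
    Γ.up (Finsupp.single x 1) y = if Γ.Adj x y then (Γ.mult x y : ℤ) else 0 := by
  simp [up, Finsupp.finsetSum_apply, Finsupp.single_apply]

open Classical in
theorem down_single_apply (x y : V) :
    Γ.down (Finsupp.single x 1) y = if Γ.Adj y x then (Γ.mult y x : ℤ) else 0 := by
  simp [down, Finsupp.finsetSum_apply, Finsupp.single_apply]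

open Classical in
theorem down_up_single_apply (x y : V) :
    Γ'.down (Γ.up (Finsupp.single x 1)) y =
      ∑ w ∈ (Γ.finite_out x).toFinset with Γ'.Adj y w, (Γ.mult x w : ℤ) * Γ'.mult y w := by
  have h : Γ.up (Finsupp.single x 1) =
      ∑ w ∈ (Γ.finite_out x).toFinset, (Γ.mult x w : ℤ) • Finsupp.single w 1 := by
    simp [up]
  rw [h, map_sum, Finsupp.finsetSum_apply, Finset.sum_filter]
  refine Finset.sum_congr rfl fun w _ => ?_
  rw [map_smul, Finsupp.smul_apply, down_single_apply]
  split_ifs <;> simp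

open Classical in
theorem up_down_single_apply (x y : V) :
    Γ.up (Γ'.down (Finsupp.single x 1)) y =
      ∑ z ∈ (Γ'.finite_in x).toFinset with Γ.Adj z y, (Γ.mult z y : ℤ) * Γ'.mult z x := by
  have h : Γ'.down (Finsupp.single x 1) =
      ∑ z ∈ (Γ'.finite_in x).toFinset, (Γ'.mult z x : ℤ) • Finsupp.single z 1 := by
    simp [down]
  rw [h, map_sum, Finsupp.finsetSum_apply, Finset.sum_filter]
  refine Finset.sum_congr rfl fun w _ => ?_
  rw [map_smul, Finsupp.smul_apply, up_single_apply]
  split_ifs <;> simp [mul_comm]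

open Classical in
theorem isDual_of_sum_eq {r : ℕ} (hh : ∀ v, Γ.h v = Γ'.h v)
    (h : ∀ x y : V,
      (∑ w ∈ (Γ.finite_out x).toFinset with Γ'.Adj y w, (Γ.mult x w : ℤ) * Γ'.mult y w) -
        ∑ z ∈ (Γ'.finite_in x).toFinset with Γ.Adj z y, (Γ.mult z y : ℤ) * Γ'.mult z x =
      if x = y then (r : ℤ) else 0) : Γ.IsDual Γ' r := by
  refine ⟨hh, ?_⟩
  refine Finsupp.lhom_ext' fun x => LinearMap.ext_ring (Finsupp.ext fun y => ?_)
  have := h x y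
  rw [← down_up_single_apply, ← up_down_single_apply] at this
  simpa [Finsupp.single_apply] using this

end GradedGraph

namespace GCM

variable {I : Type*} [DecidableEq I] {A : GCM I}

theorem weakCover_simple_mul_iff {v : A.Weyl} {i : I} :
    A.WeakCover v (A.s i * v) ↔ A.len (A.s i * v) = A.len v + 1 :=
  ⟨fun h => h.2, fun h => ⟨⟨i, rfl⟩, h⟩⟩

theorem weakCover_simple_mul_iff' {v : A.Weyl} {i : I} :
    A.WeakCover (A.s i * v) v ↔ ¬ A.len (A.s i * v) = A.len v + 1 := by
  rw [WeakCover]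
  have h := A.cs.length_simple_mul v i
  constructor
  · intro h1
    have := h1.2
    omega
  · intro h1
    exact ⟨⟨i, by rw [A.cs.simple_mul_simple_cancel_left]⟩, (h.resolve_left h1).symm⟩

variable [Fintype I]

theorem strongMult_simple_mul_self (Λ : I → ℕ) {v : A.Weyl} {i : I}
    (h : A.WeakCover (A.s i * v) v) :
    (A.strongMult Λ (A.s i * v) v : ℤ) = -A.corootPairing Λ v⁻¹ i := by
  have h1 : A.s i * (A.s i * v) = v := A.cs.simple_mul_simple_cancel_left i
  have h2 := strongMult_simple_mul Λ (v := A.s i * v) (i := i) (by rw [h1]; exact h.2)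
  rwa [h1, corootPairing_inv_simple_mul] at h2

theorem weakMult_simple_mul_self (K : I → ℕ) (v : A.Weyl) (i : I) :
    A.weakMult K (A.s i * v) v = K i := by
  have := weakMult_simple_mul K (A.s i * v) i
  rwa [A.cs.simple_mul_simple_cancel_left] at this

/-- The strong and weak graphs of a central element are dual (Lam and Shimozono). -/
theorem isDual_strongGraph_weakGraph {K : I → ℕ} (hK : A.IsCentral K) (i' : I) :
    GradedGraph.IsDual (A.strongGraph (Pi.single i' 1)) (A.weakGraph K) (K i') := by
  classical
  refine GradedGraph.isDual_of_sum_eq _ _ (fun _ => rfl) fun x y => ?_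
  split_ifs with hxy
  · subst hxy
    set Λ : I → ℕ := Pi.single i' 1
    have h1 : ∑ w ∈ ((A.strongGraph Λ).finite_out x).toFinset with (A.weakGraph K).Adj x w,
          ((A.strongGraph Λ).mult x w : ℤ) * (A.weakGraph K).mult x w =
        ∑ i with A.len (A.s i * x) = A.len x + 1, (K i : ℤ) * A.corootPairing Λ x⁻¹ i := by
      symm
      refine Finset.sum_bij (fun i _ => A.s i * x) ?_ ?_ ?_ ?_
      · intro i hi
        have hi := weakCover_simple_mul_iff.2 (Finset.mem_filter.1 hi).2
        exact Finset.mem_filter.2 ⟨(Set.Finite.mem_toFinset _).2 hi.strongCover, hi⟩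
      · intro i _ j _ hij
        exact simple_injective (mul_right_cancel hij)
      · intro w hw
        obtain ⟨⟨i, rfl⟩, hi⟩ := (Finset.mem_filter.1 hw).2
        exact ⟨i, by simpa using hi, rfl⟩
      · intro i hi
        change _ = (A.strongMult Λ x (A.s i * x) : ℤ) * (A.weakMult K x (A.s i * x) : ℤ)
        rw [strongMult_simple_mul Λ (Finset.mem_filter.1 hi).2, weakMult_simple_mul, mul_comm]
    have h2 : ∑ z ∈ ((A.weakGraph K).finite_in x).toFinset with (A.strongGraph Λ).Adj z x,
          ((A.strongGraph Λ).mult z x : ℤ) * (A.weakGraph K).mult z x =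
        ∑ i with ¬ A.len (A.s i * x) = A.len x + 1, -((K i : ℤ) * A.corootPairing Λ x⁻¹ i) := by
      symm
      refine Finset.sum_bij (fun i _ => A.s i * x) ?_ ?_ ?_ ?_
      · intro i hi
        have hi := weakCover_simple_mul_iff'.2 (Finset.mem_filter.1 hi).2
        exact Finset.mem_filter.2 ⟨(Set.Finite.mem_toFinset _).2 hi, hi.strongCover⟩
      · intro i _ j _ hij
        exact simple_injective (mul_right_cancel hij)
      · intro z hz
        have hz' : A.WeakCover z x := 
          ((A.weakGraph K).finite_in x).mem_toFinset.1 (Finset.mem_filter.1 hz).1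
        obtain ⟨i, hi⟩ := hz'.1
        have hzi : z = A.s i * x := by rw [hi, A.cs.simple_mul_simple_cancel_left]
        rw [hzi] at hz'
        exact ⟨i, by simpa using weakCover_simple_mul_iff'.1 hz', hzi.symm⟩
      · intro i hi
        change _ = (A.strongMult Λ (A.s i * x) x : ℤ) * (A.weakMult K (A.s i * x) x : ℤ)
        rw [strongMult_simple_mul_self Λ (weakCover_simple_mul_iff'.2 (Finset.mem_filter.1 hi).2),
          weakMult_simple_mul_self]
        ring
    rw [h1, h2, Finset.sum_neg_distrib, sub_neg_eq_add, Finset.sum_filter_add_sum_filter_not,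
      sum_mul_corootPairing hK]
    simp [Λ, Pi.single_apply]
  · rw [sub_eq_zero]
    refine Finset.sum_nbij' (fun w => y * w⁻¹ * x) (fun z => x * z⁻¹ * y) ?_ ?_ ?_ ?_ ?_
    · intro w hw
      simp only [Finset.mem_filter, Set.Finite.mem_toFinset] at hw ⊢
      exact (StrongCover.natural_symm hxy hw.1 hw.2).symm
    · intro z hz
      simp only [Finset.mem_filter, Set.Finite.mem_toFinset] at hz ⊢
      exact StrongCover.natural hxy hz.2 hz.1
    · intro w _
      simp [mul_assoc]
    · intro z _
      simp [mul_assoc]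
    · intro w hw
      simp only [Finset.mem_filter, Set.Finite.mem_toFinset] at hw
      obtain ⟨h1, h2⟩ := StrongCover.natural_symm hxy hw.1 hw.2
      change (A.strongMult _ x w : ℤ) * (A.weakMult K y w : ℤ) =
        (A.strongMult _ (y * w⁻¹ * x) y : ℤ) * (A.weakMult K (y * w⁻¹ * x) x : ℤ)
      rw [strongMult_congr _ (v := x) (w := w) (v' := y * w⁻¹ * x) (w' := y) (by group),
        WeakCover.weakMult_eq K h2 (w := w) (y := y) (by group)]

end GCM

end Duality

section GrowthDiagrams

namespace GradedGraph

variable {V : Type*} {Γ : GradedGraph V}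

/-- A possibly degenerate marked step: a marked edge, or an equality with marking `0`. -/
def IsStep (Γ : GradedGraph V) (v w : V) (m : ℕ) : Prop :=
  (v = w ∧ m = 0) ∨ (Γ.Adj v w ∧ m ∈ Set.Icc 1 (Γ.mult v w))

theorem Adj.ne {v w : V} (h : Γ.Adj v w) : v ≠ w := by
  rintro rfl
  have := Γ.h_adj _ _ h
  omega

theorem IsStep.eq_zero {v m} (h : Γ.IsStep v v m) : m = 0 :=
  h.elim And.right fun h => absurd rfl h.1.ne

theorem IsStep.edge {v w m} (h : Γ.IsStep v w m) (hvw : v ≠ w) :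
    Γ.Adj v w ∧ m ∈ Set.Icc 1 (Γ.mult v w) :=
  h.resolve_left fun h => hvw h.1

theorem IsStep.eq_of_h_eq_zero {v w m} (h : Γ.IsStep v w m) (hw : Γ.h w = 0) : v = w :=
  h.elim And.left fun h => by
    have := Γ.h_adj _ _ h.1
    omega

theorem isStep_self (v : V) : Γ.IsStep v v 0 := Or.inl ⟨rfl, rfl⟩

end GradedGraph

open GradedGraph

theorem exists_grid {S : Type*} (top left : ℕ → S) (step : ℕ → ℕ → S → S → S → S) :
    ∃ F : ℕ → ℕ → S, (∀ j, F 0 j = top j) ∧ (∀ i, F (i + 1) 0 = left i) ∧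
      ∀ i j, F (i + 1) (j + 1) = step i j (F i j) (F i (j + 1)) (F (i + 1) j) :=
  ⟨fun i => Nat.rec top (fun i row => Nat.rec (left i)
      fun j prev => step i j (row j) (row (j + 1)) prev) i,
    fun _ => rfl, fun _ => rfl, fun _ _ => rfl⟩

theorem existsUnique_drop {n : ℕ} {d : Fin (n + 1) → Prop} {e : Fin n → Prop}
    (h0 : d 0) (hlast : ¬ d (Fin.last n)) (hd : ∀ j, d j.succ ↔ d j.castSucc ∧ ¬ e j)
    (he : ∀ j, e j → d j.castSucc) : ∃! j, e j := by
  have hex : ∃ j, e j := by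
    by_contra hcon
    push Not at hcon
    refine hlast (Fin.induction (motive := fun k => d k) h0 (fun j hj => ?_) (Fin.last n))
    exact (hd j).2 ⟨hj, hcon j⟩
  have hmono : ∀ (k l : Fin (n + 1)), k ≤ l → d l → d k := by
    intro k l
    induction l using Fin.induction with
    | zero => intro hkl _; rwa [Fin.le_zero_iff.1 hkl]
    | succ l ih =>
      intro hkl hl
      rcases hkl.eq_or_lt with rfl | hlt
      · exact hl
      · exact ih (Fin.le_castSucc_iff.2 hlt) ((hd l).1 hl).1
  have hlt : ∀ j k, e j → e k → ¬ j < k := by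
    intro j k hj hk hjk
    have := hmono j.succ k.castSucc (Fin.succ_le_castSucc_iff.2 hjk) (he k hk)
    exact ((hd j).1 this).2 hj
  obtain ⟨j, hj⟩ := hex
  exact ⟨j, hj, fun k hk => le_antisymm (not_lt.1 (hlt j k hj hk)) (not_lt.1 (hlt k j hk hj))⟩

namespace DifferentialBijection

variable {V : Type*} {Γ Γ' : GradedGraph V} {r : ℕ} {Φ : DifferentialBijection Γ Γ' r}

/-- The inputs of a local rule are marked steps, and the entry is `0` unless both are
degenerate. -/
def IsInput (Γ Γ' : GradedGraph V) (c : Option (Fin r)) (z y x : V) (m m' : ℕ) : Prop :=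
  Γ.IsStep z y m ∧ Γ'.IsStep z x m' ∧ (c ≠ none → z = x ∧ z = y)

theorem LocalRule.unique {c : Option (Fin r)} {z y x w w₂ : V} {m m' M M' M₂ M₂' : ℕ}
    (h : Φ.LocalRule c z y x w m m' M M') (h₂ : Φ.LocalRule c z y x w₂ m m' M₂ M₂') :
    w = w₂ ∧ M = M₂ ∧ M' = M₂' := by
  obtain ⟨a1, a2, a3, a4, a5, a6⟩ := h
  obtain ⟨b1, b2, b3, b4, b5, b6⟩ := h₂
  by_cases hzx : z = x <;> by_cases hzy : z = y
  · rcases c with _ | k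
    · obtain ⟨p1, p2, p3⟩ := a1 hzx hzy rfl
      obtain ⟨q1, q2, q3⟩ := b1 hzx hzy rfl
      exact ⟨p1.trans q1.symm, p2.trans q2.symm, p3.trans q3.symm⟩
    · simpa using (a2 hzx hzy k rfl).symm.trans (b2 hzx hzy k rfl)
  · obtain ⟨p1, p2, p3⟩ := a5 hzx hzy
    obtain ⟨q1, q2, q3⟩ := b5 hzx hzy
    exact ⟨p1.trans q1.symm, p2.trans q2.symm, p3.trans q3.symm⟩
  · obtain ⟨p1, p2, p3⟩ := a4 hzy hzx
    obtain ⟨q1, q2, q3⟩ := b4 hzy hzx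
    exact ⟨p1.trans q1.symm, p2.trans q2.symm, p3.trans q3.symm⟩
  · by_cases hxy : x = y
    · obtain ⟨_, p⟩ := a3 hzx hxy
      obtain ⟨_, q⟩ := b3 hzx hxy
      simpa using p.symm.trans q
    · obtain ⟨_, p⟩ := a6 hzx hzy hxy
      obtain ⟨_, q⟩ := b6 hzx hzy hxy
      simpa using p.symm.trans q

theorem exists_localRule {c : Option (Fin r)} {z y x : V} {m m' : ℕ}
    (h : IsInput Γ Γ' c z y x m m') : ∃ w M M', Φ.LocalRule c z y x w m m' M M' := by
  obtain ⟨h1, h2, h3⟩ := h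
  by_cases hzx : z = x <;> by_cases hzy : z = y
  · rcases c with _ | k
    · exact ⟨z, 0, 0, by simp [LocalRule, hzx, ← hzy]⟩
    · refine ⟨(Φ.diag x (Sum.inl k)).1.1, (Φ.diag x (Sum.inl k)).1.2.1,
        (Φ.diag x (Sum.inl k)).1.2.2, ?_⟩
      simp [LocalRule, hzx, ← hzy]
  · exact ⟨y, m, 0, by simp [LocalRule, hzx, hzx ▸ hzy]⟩
  · subst hzy
    exact ⟨x, 0, m', by simp [LocalRule, hzx, Ne.symm hzx]⟩
  · have e1 := h1.edge hzy
    have e2 := h2.edge hzx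
    have ht : (z, m, m') ∈ UD Γ Γ' x y := ⟨e1.1, e2.1, e1.2, e2.2⟩
    by_cases hxy : x = y
    · subst hxy
      refine ⟨(Φ.diag x (Sum.inr ⟨_, ht⟩)).1.1, (Φ.diag x (Sum.inr ⟨_, ht⟩)).1.2.1,
        (Φ.diag x (Sum.inr ⟨_, ht⟩)).1.2.2, ?_, ?_, fun _ _ => ⟨ht, rfl⟩, ?_, ?_, ?_⟩ <;> simp [hzx]
    · refine ⟨(Φ.off x y hxy ⟨_, ht⟩).1.1, (Φ.off x y hxy ⟨_, ht⟩).1.2.1,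
        (Φ.off x y hxy ⟨_, ht⟩).1.2.2, ?_, ?_, ?_, ?_, ?_, fun _ _ _ => ⟨ht, rfl⟩⟩ <;>
        simp [hzx, hzy, hxy]

theorem LocalRule.output {c : Option (Fin r)} {z y x w : V} {m m' M M' : ℕ}
    (h : Φ.LocalRule c z y x w m m' M M') (hi : IsInput Γ Γ' c z y x m m') :
    Γ.IsStep x w M ∧ Γ'.IsStep y w M' ∧ (x = w ↔ z = y ∧ c = none) ∧
      (y = w ↔ z = x ∧ c = none) := by
  obtain ⟨a1, a2, a3, a4, a5, a6⟩ := h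
  obtain ⟨h1, h2, h3⟩ := hi
  have hmem : ∀ {x y}, (w, M, M') ∈ DU Γ Γ' x y → Γ.IsStep x w M ∧ Γ'.IsStep y w M' ∧
      x ≠ w ∧ y ≠ w := fun ht =>
    ⟨Or.inr ⟨ht.1, ht.2.2.1⟩, Or.inr ⟨ht.2.1, ht.2.2.2⟩, ht.1.ne, ht.2.1.ne⟩
  by_cases hzx : z = x <;> by_cases hzy : z = y
  · rcases c with _ | k
    · obtain ⟨rfl, rfl, rfl⟩ := a1 hzx hzy rfl
      subst hzx hzy
      simp [isStep_self]
    · have ht := (Φ.diag x (Sum.inl k)).2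
      rw [a2 hzx hzy k rfl] at ht
      obtain ⟨e1, e2, e3, e4⟩ := hmem ht
      subst hzx hzy
      simp [e1, e2, e3]
  · obtain ⟨rfl, rfl, rfl⟩ := a5 hzx hzy
    subst hzx
    have hc : c = none := by_contra fun hc => hzy (h3 hc).2
    simp [isStep_self, h1, hc]
  · obtain ⟨rfl, rfl, rfl⟩ := a4 hzy hzx
    subst hzy
    have hc : c = none := by_contra fun hc => hzx (h3 hc).1
    simp [isStep_self, h2, hc]
  · by_cases hxy : x = y
    · obtain ⟨hs, p⟩ := a3 hzx hxy
      have ht := (Φ.diag x (Sum.inr ⟨_, hs⟩)).2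
      rw [p] at ht
      obtain ⟨e1, e2, e3, e4⟩ := hmem ht
      subst hxy
      simp [e1, e2, e3, hzx]
    · obtain ⟨hs, p⟩ := a6 hzx hzy hxy
      have ht := (Φ.off x y hxy ⟨_, hs⟩).2
      rw [p] at ht
      obtain ⟨e1, e2, e3, e4⟩ := hmem ht
      simp [e1, e2, e3, e4, hzx, hzy]

theorem exists_localRule_backward {z' y x : V} {M M' : ℕ} (h1 : Γ.IsStep x z' M)
    (h2 : Γ'.IsStep y z' M') : ∃ c z m m', IsInput Γ Γ' c z y x m m' ∧
      Φ.LocalRule c z y x z' m m' M M' := by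
  by_cases hx : x = z' <;> by_cases hy : y = z'
  · subst hx hy
    refine ⟨none, y, 0, 0, ⟨isStep_self _, isStep_self _, by simp⟩, ?_⟩
    simp [LocalRule, h1.eq_zero, h2.eq_zero]
  · subst hx
    exact ⟨none, y, 0, M', ⟨isStep_self _, h2, by simp⟩, 
      by simp [LocalRule, h1.eq_zero, hy, Ne.symm hy]⟩
  · subst hy
    exact ⟨none, x, M, 0, ⟨h1, isStep_self _, by simp⟩, 
      by simp [LocalRule, h2.eq_zero, hx, Ne.symm hx]⟩
  · have e1 := h1.edge hx
    have e2 := h2.edge hy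
    have ht : (z', M, M') ∈ DU Γ Γ' x y := ⟨e1.1, e2.1, e1.2, e2.2⟩
    by_cases hxy : x = y
    · subst hxy
      rcases hs : (Φ.diag x).symm ⟨_, ht⟩ with k | ⟨⟨z, m, m'⟩, hu⟩
      · refine ⟨some k, x, 0, 0, ⟨isStep_self _, isStep_self _, by simp⟩, ?_⟩
        rw [Equiv.symm_apply_eq] at hs
        simp [LocalRule, ← hs]
      · rw [Equiv.symm_apply_eq] at hs
        refine ⟨none, z, m, m', ⟨Or.inr ⟨hu.1, hu.2.2.1⟩, Or.inr ⟨hu.2.1, hu.2.2.2⟩, by simp⟩, ?_⟩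
        have hzx : z ≠ x := hu.1.ne
        exact ⟨fun h => absurd h hzx, fun h => absurd h hzx, fun _ _ => ⟨hu, by rw [← hs]⟩,
          fun h => absurd h hzx, fun h => absurd h hzx, fun _ _ h => absurd rfl h⟩
    · rcases hs : (Φ.off x y hxy).symm ⟨_, ht⟩ with ⟨⟨z, m, m'⟩, hu⟩
      rw [Equiv.symm_apply_eq] at hs
      refine ⟨none, z, m, m', ⟨Or.inr ⟨hu.1, hu.2.2.1⟩, Or.inr ⟨hu.2.1, hu.2.2.2⟩, by simp⟩, ?_⟩
      have hzy : z ≠ y := hu.1.ne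
      have hzx : z ≠ x := hu.2.1.ne
      exact ⟨fun h => absurd h hzx, fun h => absurd h hzx, fun _ h => absurd h hxy,
        fun h => absurd h hzy, fun h => absurd h hzx, fun _ _ _ => ⟨hu, by rw [← hs]⟩⟩

theorem LocalRule.unique_backward {c c₂ : Option (Fin r)} {z z₂ y x w : V}
    {m m' m₂ m₂' M M' : ℕ} (hi : IsInput Γ Γ' c z y x m m')
    (h : Φ.LocalRule c z y x w m m' M M') (hi₂ : IsInput Γ Γ' c₂ z₂ y x m₂ m₂')
    (h₂ : Φ.LocalRule c₂ z₂ y x w m₂ m₂' M M') :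
    c = c₂ ∧ z = z₂ ∧ m = m₂ ∧ m' = m₂' := by
  obtain ⟨-, -, hx, hy⟩ := h.output hi
  obtain ⟨-, -, hx₂, hy₂⟩ := h₂.output hi₂
  obtain ⟨i1, i2, i3⟩ := hi
  obtain ⟨j1, j2, j3⟩ := hi₂
  obtain ⟨a1, a2, a3, a4, a5, a6⟩ := h
  obtain ⟨b1, b2, b3, b4, b5, b6⟩ := h₂
  by_cases hxw : x = w <;> by_cases hyw : y = w
  · obtain ⟨rfl, rfl⟩ := hx.1 hxw
    obtain ⟨rfl, rfl⟩ := hx₂.1 hxw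
    obtain ⟨rfl, -⟩ := hy.1 hyw
    simp [i1.eq_zero, i2.eq_zero, j1.eq_zero, j2.eq_zero]
  · obtain ⟨rfl, rfl⟩ := hx.1 hxw
    obtain ⟨rfl, rfl⟩ := hx₂.1 hxw
    have hne : z₂ ≠ x := fun h => hyw (hy.2 ⟨h, rfl⟩)
    simp [i1.eq_zero, j1.eq_zero, ← (a4 rfl hne).2.2, ← (b4 rfl hne).2.2]
  · obtain ⟨rfl, rfl⟩ := hy.1 hyw
    obtain ⟨rfl, rfl⟩ := hy₂.1 hyw
    have hne : z₂ ≠ y := fun h => hxw (hx.2 ⟨h, rfl⟩)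
    simp [i2.eq_zero, j2.eq_zero, ← (a5 rfl hne).2.1, ← (b5 rfl hne).2.1]
  · by_cases hxy : x = y
    · subst hxy
      have key : ∀ {c : Option (Fin r)} {z m m'}, Γ.IsStep z x m → Γ'.IsStep z x m' →
          (c ≠ none → z = x ∧ z = x) → ¬ (z = x ∧ c = none) →
          (z = x → z = x → ∀ k, c = some k → (Φ.diag x (Sum.inl k)).1 = (w, M, M')) →
          (z ≠ x → x = x → ∃ ht : (z, m, m') ∈ UD Γ Γ' x x,
            (Φ.diag x (Sum.inr ⟨(z, m, m'), ht⟩)).1 = (w, M, M')) →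
          (∃ k, c = some k ∧ z = x ∧ m = 0 ∧ m' = 0 ∧ (Φ.diag x (Sum.inl k)).1 = (w, M, M')) ∨
          (c = none ∧ ∃ ht : (z, m, m') ∈ UD Γ Γ' x x,
            (Φ.diag x (Sum.inr ⟨(z, m, m'), ht⟩)).1 = (w, M, M')) := by
        intro c z m m' s1 s2 s3 s4 s5 s6
        rcases c with _ | k
        · have hzx : z ≠ x := fun h => s4 ⟨h, rfl⟩
          exact Or.inr ⟨rfl, s6 hzx rfl⟩
        · obtain ⟨rfl, -⟩ := s3 (by simp)
          exact Or.inl ⟨k, rfl, rfl, s1.eq_zero, s2.eq_zero, s5 rfl rfl k rfl⟩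
      have e1 := key i1 i2 i3 (mt hx.2 hxw) a2 a3
      have e2 := key j1 j2 j3 (mt hx₂.2 hxw) b2 b3
      rcases e1 with ⟨k, rfl, rfl, rfl, rfl, p⟩ | ⟨rfl, ht, p⟩ <;>
        rcases e2 with ⟨k₂, rfl, h', rfl, rfl, q⟩ | ⟨rfl, ht₂, q⟩
      · have := (Φ.diag _).injective (Subtype.ext (p.trans q.symm))
        have hk : k = k₂ := by simpa using this
        subst hk
        exact ⟨rfl, h'.symm, rfl, rfl⟩
      · have := (Φ.diag _).injective (Subtype.ext (p.trans q.symm))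
        simp at this
      · have := (Φ.diag _).injective (Subtype.ext (p.trans q.symm))
        simp at this
      · have := (Φ.diag _).injective (Subtype.ext (p.trans q.symm))
        simpa using this
    · have hc : c = none := by_contra fun hc => hxy ((i3 hc).1.symm.trans (i3 hc).2)
      have hc₂ : c₂ = none := by_contra fun hc => hxy ((j3 hc).1.symm.trans (j3 hc).2)
      obtain ⟨_, p⟩ := a6 (fun h => hyw (hy.2 ⟨h, hc⟩)) (fun h => hxw (hx.2 ⟨h, hc⟩)) hxy
      obtain ⟨_, q⟩ := b6 (fun h => hyw (hy₂.2 ⟨h, hc₂⟩)) (fun h => hxw (hx₂.2 ⟨h, hc₂⟩)) hxy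
      have := (Φ.off x y hxy).injective (Subtype.ext (p.trans q.symm))
      refine ⟨hc.trans hc₂.symm, ?_⟩
      simpa using this

variable {n : ℕ} {b : V}

theorem entry_ne_none_iff {σ : ColoredPerm n r} {i j : Fin n} :
    σ.entry i j ≠ none ↔ σ.1 i = j := by
  simp [ColoredPerm.entry]

/-- The boundary conditions of a growth diagram, and the local rules for squares with legitimate
inputs. -/
def IsPreGrowth (Φ : DifferentialBijection Γ Γ' r) (b : V) (σ : ColoredPerm n r)
    (G : GrowthDiagram V n) : Prop :=
  (∀ j, G.vert 0 j = b) ∧ (∀ i, G.vert i 0 = b) ∧ (∀ j, G.row 0 j = 0) ∧ (∀ i, G.col i 0 = 0) ∧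
  ∀ i j : Fin n, IsInput Γ Γ' (σ.entry i j)
      (G.vert i.castSucc j.castSucc) (G.vert i.castSucc j.succ)
      (G.vert i.succ j.castSucc) (G.row i.castSucc j) (G.col i j.castSucc) →
    Φ.LocalRule (σ.entry i j)
      (G.vert i.castSucc j.castSucc) (G.vert i.castSucc j.succ)
      (G.vert i.succ j.castSucc) (G.vert i.succ j.succ)
      (G.row i.castSucc j) (G.col i j.castSucc) (G.row i.succ j) (G.col i j.succ)

theorem IsGrowth.isPreGrowth {σ : ColoredPerm n r} {G : GrowthDiagram V n}
    (h : Φ.IsGrowth b σ G) : Φ.IsPreGrowth b σ G :=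
  ⟨h.1, h.2.1, h.2.2.1, h.2.2.2.1, fun i j _ => h.2.2.2.2 i j⟩

theorem IsPreGrowth.regular {σ : ColoredPerm n r} {G : GrowthDiagram V n}
    (h : Φ.IsPreGrowth b σ G) :
    (∀ (i : Fin (n + 1)) (j : Fin n), Γ.IsStep (G.vert i j.castSucc) (G.vert i j.succ) (G.row i j) ∧
      (G.vert i j.castSucc = G.vert i j.succ ↔ (i : ℕ) ≤ σ.1.symm j)) ∧
    (∀ (i : Fin n) (j : Fin (n + 1)), Γ'.IsStep (G.vert i.castSucc j) (G.vert i.succ j) (G.col i j) ∧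
      (G.vert i.castSucc j = G.vert i.succ j ↔ (j : ℕ) ≤ σ.1 i)) := by
  obtain ⟨h1, h2, h3, h4, h5⟩ := h
  have cell : ∀ i j : Fin n,
      (Γ.IsStep (G.vert i.castSucc j.castSucc) (G.vert i.castSucc j.succ) (G.row i.castSucc j) ∧
        (G.vert i.castSucc j.castSucc = G.vert i.castSucc j.succ ↔ (i : ℕ) ≤ σ.1.symm j)) →
      (Γ'.IsStep (G.vert i.castSucc j.castSucc) (G.vert i.succ j.castSucc) (G.col i j.castSucc) ∧
        (G.vert i.castSucc j.castSucc = G.vert i.succ j.castSucc ↔ (j : ℕ) ≤ σ.1 i)) →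
      (Γ.IsStep (G.vert i.succ j.castSucc) (G.vert i.succ j.succ) (G.row i.succ j) ∧
        (G.vert i.succ j.castSucc = G.vert i.succ j.succ ↔ (i : ℕ) + 1 ≤ σ.1.symm j)) ∧
      (Γ'.IsStep (G.vert i.castSucc j.succ) (G.vert i.succ j.succ) (G.col i j.succ) ∧
        (G.vert i.castSucc j.succ = G.vert i.succ j.succ ↔ (j : ℕ) + 1 ≤ σ.1 i)) := by
    intro i j hr hc
    have hin : IsInput Γ Γ' (σ.entry i j)
        (G.vert i.castSucc j.castSucc) (G.vert i.castSucc j.succ)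
        (G.vert i.succ j.castSucc) (G.row i.castSucc j) (G.col i j.castSucc) := by
      refine ⟨hr.1, hc.1, fun he => ?_⟩
      rw [entry_ne_none_iff] at he
      rw [hc.2, hr.2, ← he]
      simp
    obtain ⟨o1, o2, o3, o4⟩ := (h5 i j hin).output hin
    have hnone : σ.entry i j = none ↔ σ.1 i ≠ j :=
      not_iff_not.1 (entry_ne_none_iff.trans not_not.symm)
    have hnone' : σ.1 i ≠ j ↔ i ≠ σ.1.symm j := by
      rw [Ne, Ne, Equiv.eq_symm_apply]
    refine ⟨⟨o1, ?_⟩, o2, ?_⟩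
    · rw [o3, hr.2, hnone, hnone', Ne, Fin.ext_iff]
      omega
    · rw [o4, hc.2, hnone, Ne, Fin.ext_iff]
      omega
  have cols : ∀ i : Fin n,
      (∀ j : Fin n, Γ.IsStep (G.vert i.castSucc j.castSucc) (G.vert i.castSucc j.succ)
          (G.row i.castSucc j) ∧
        (G.vert i.castSucc j.castSucc = G.vert i.castSucc j.succ ↔ (i : ℕ) ≤ σ.1.symm j)) →
      ∀ j : Fin (n + 1), Γ'.IsStep (G.vert i.castSucc j) (G.vert i.succ j) (G.col i j) ∧
        (G.vert i.castSucc j = G.vert i.succ j ↔ (j : ℕ) ≤ σ.1 i) := by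
    intro i hr j
    induction j using Fin.induction with
    | zero => simp [h2, h4, isStep_self]
    | succ j ih => exact (cell i j (hr j) ih).2
  have rows : ∀ (i : Fin (n + 1)) (j : Fin n),
      Γ.IsStep (G.vert i j.castSucc) (G.vert i j.succ) (G.row i j) ∧
      (G.vert i j.castSucc = G.vert i j.succ ↔ (i : ℕ) ≤ σ.1.symm j) := by
    intro i
    induction i using Fin.induction with
    | zero => simp [h1, h3, isStep_self]
    | succ i ih => exact fun j => (cell i j (ih j) (cols i ih j.castSucc)).1
  exact ⟨rows, fun i => cols i (rows i.castSucc)⟩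

theorem IsPreGrowth.isInput {σ : ColoredPerm n r} {G : GrowthDiagram V n}
    (h : Φ.IsPreGrowth b σ G) (i j : Fin n) : IsInput Γ Γ' (σ.entry i j)
      (G.vert i.castSucc j.castSucc) (G.vert i.castSucc j.succ)
      (G.vert i.succ j.castSucc) (G.row i.castSucc j) (G.col i j.castSucc) := by
  obtain ⟨h1, h2⟩ := h.regular
  refine ⟨(h1 _ _).1, (h2 _ _).1, fun he => ?_⟩
  rw [entry_ne_none_iff] at he
  rw [(h1 _ _).2, (h2 _ _).2, ← he]
  simp

theorem IsPreGrowth.isGrowth {σ : ColoredPerm n r} {G : GrowthDiagram V n}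
    (h : Φ.IsPreGrowth b σ G) : Φ.IsGrowth b σ G :=
  ⟨h.1, h.2.1, h.2.2.1, h.2.2.2.1, fun i j => h.2.2.2.2 i j (h.isInput i j)⟩

theorem exists_isGrowth (Φ : DifferentialBijection Γ Γ' r) (b : V) (σ : ColoredPerm n r) :
    ∃ G, Φ.IsGrowth b σ G := by
  have hstep : ∀ (i j : ℕ) (s t u : V × ℕ × ℕ), ∃ o : V × ℕ × ℕ, ∀ (hi : i < n) (hj : j < n),
      IsInput Γ Γ' (σ.entry ⟨i, hi⟩ ⟨j, hj⟩) s.1 t.1 u.1 t.2.1 u.2.2 →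
      Φ.LocalRule (σ.entry ⟨i, hi⟩ ⟨j, hj⟩) s.1 t.1 u.1 o.1 t.2.1 u.2.2 o.2.1 o.2.2 := by
    intro i j s t u
    by_cases h : ∃ (hi : i < n) (hj : j < n),
        IsInput Γ Γ' (σ.entry ⟨i, hi⟩ ⟨j, hj⟩) s.1 t.1 u.1 t.2.1 u.2.2
    · obtain ⟨hi, hj, h⟩ := h
      obtain ⟨w, M, M', hw⟩ := exists_localRule (Φ := Φ) h
      exact ⟨(w, M, M'), fun _ _ _ => hw⟩
    · exact ⟨(b, 0, 0), fun hi hj h' => absurd ⟨hi, hj, h'⟩ h⟩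
  choose step hstep using hstep
  obtain ⟨F, F1, F2, F3⟩ := exists_grid (fun _ => (b, 0, 0)) (fun _ => (b, 0, 0)) step
  refine ⟨⟨fun i j => (F i j).1, fun i j => (F i (j + 1)).2.1, fun i j => (F (i + 1) j).2.2⟩,
    IsPreGrowth.isGrowth ⟨?_, ?_, ?_, ?_, ?_⟩⟩
  · intro j
    simp [F1]
  · intro i
    induction i using Fin.cases with
    | zero => simp [F1]
    | succ i => simp [F2]
  · intro j
    simp [F1]
  · intro i
    simp [F2]
  · intro i j hin
    have := hstep i j (F i j) (F i (j + 1)) (F (i + 1) j) i.2 j.2 hin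
    simpa [F3] using this

theorem _root_.GrowthDiagram.ext' {G G₂ : GrowthDiagram V n} (h1 : ∀ i j, G.vert i j = G₂.vert i j)
    (h2 : ∀ i j, G.row i j = G₂.row i j) (h3 : ∀ i j, G.col i j = G₂.col i j) : G = G₂ := by
  cases G
  cases G₂
  congr
  · funext i j
    exact h1 i j
  · funext i j
    exact h2 i j
  · funext i j
    exact h3 i j

theorem IsGrowth.unique {σ : ColoredPerm n r} {G G₂ : GrowthDiagram V n}
    (h : Φ.IsGrowth b σ G) (h₂ : Φ.IsGrowth b σ G₂) : G = G₂ := by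
  obtain ⟨a1, a2, a3, a4, a5⟩ := h
  obtain ⟨b1, b2, b3, b4, b5⟩ := h₂
  have cols : ∀ i : Fin n, (∀ j, G.vert i.castSucc j = G₂.vert i.castSucc j) →
      (∀ j, G.row i.castSucc j = G₂.row i.castSucc j) →
      ∀ j, G.vert i.succ j = G₂.vert i.succ j ∧ G.col i j = G₂.col i j := by
    intro i e1 e2 j
    induction j using Fin.induction with
    | zero => simp [a2, b2, a4, b4]
    | succ j ih =>
      have p := a5 i j
      have q := b5 i j
      rw [e1, e1, e2, ih.1, ih.2] at p
      obtain ⟨u1, -, u2⟩ := p.unique q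
      exact ⟨u1, u2⟩
  have rows : ∀ i, (∀ j, G.vert i j = G₂.vert i j) ∧ ∀ j, G.row i j = G₂.row i j := by
    intro i
    induction i using Fin.induction with
    | zero => simp [a1, b1, a3, b3]
    | succ i ih =>
      have hc := cols i ih.1 ih.2
      refine ⟨fun j => (hc j).1, fun j => ?_⟩
      have p := a5 i j
      have q := b5 i j
      rw [ih.1, ih.1, ih.2, (hc _).1, (hc _).2] at p
      exact (p.unique q).2.1
  exact GrowthDiagram.ext' (fun i => (rows i).1) (fun i => (rows i).2)
    fun i j => (cols i (rows _).1 (rows _).2 j).2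

theorem IsGrowth.perm_unique {σ τ : ColoredPerm n r} {G G₂ : GrowthDiagram V n}
    (h : Φ.IsGrowth b σ G) (h₂ : Φ.IsGrowth b τ G₂)
    (e1 : ∀ k, G.vert (Fin.last n) k = G₂.vert (Fin.last n) k)
    (e2 : ∀ k, G.row (Fin.last n) k = G₂.row (Fin.last n) k)
    (e3 : ∀ k, G.vert k (Fin.last n) = G₂.vert k (Fin.last n))
    (e4 : ∀ k, G.col k (Fin.last n) = G₂.col k (Fin.last n)) : σ = τ := by
  have cell : ∀ i j : Fin n, G.vert i.castSucc j.succ = G₂.vert i.castSucc j.succ →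
      G.vert i.succ j.castSucc = G₂.vert i.succ j.castSucc →
      G.vert i.succ j.succ = G₂.vert i.succ j.succ → G.row i.succ j = G₂.row i.succ j →
      G.col i j.succ = G₂.col i j.succ → σ.entry i j = τ.entry i j ∧
      G.vert i.castSucc j.castSucc = G₂.vert i.castSucc j.castSucc ∧
      G.row i.castSucc j = G₂.row i.castSucc j ∧
      G.col i j.castSucc = G₂.col i j.castSucc := by
    intro i j p1 p2 p3 p4 p5
    have i1 := h.isPreGrowth.isInput i j
    have r1 := h.2.2.2.2 i j
    rw [p1, p2] at i1
    rw [p1, p2, p3, p4, p5] at r1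
    exact LocalRule.unique_backward i1 r1 (h₂.isPreGrowth.isInput i j) (h₂.2.2.2.2 i j)
  have cols : ∀ i : Fin n, (∀ j, G.vert i.succ j = G₂.vert i.succ j) →
      (∀ j, G.row i.succ j = G₂.row i.succ j) →
      ∀ j, G.vert i.castSucc j = G₂.vert i.castSucc j ∧ G.col i j = G₂.col i j := by
    intro i p1 p2 j
    induction j using Fin.reverseInduction with
    | last => exact ⟨e3 _, e4 _⟩
    | cast j ih =>
      have := cell i j ih.1 (p1 _) (p1 _) (p2 _) ih.2
      exact ⟨this.2.1, this.2.2.2⟩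
  have rows : ∀ i, (∀ j, G.vert i j = G₂.vert i j) ∧ ∀ j, G.row i j = G₂.row i j := by
    intro i
    induction i using Fin.reverseInduction with
    | last => exact ⟨e1, e2⟩
    | cast i ih =>
      have hc := cols i ih.1 ih.2
      exact ⟨fun j => (hc j).1,
        fun j => (cell i j (hc _).1 (ih.1 _) (ih.1 _) (ih.2 _) (hc _).2).2.2.1⟩
  have hentry : ∀ i j, σ.entry i j = τ.entry i j := fun i j =>
    (cell i j ((rows _).1 _) ((rows _).1 _) ((rows _).1 _) ((rows _).2 _)
      (cols i (rows _).1 (rows _).2 _).2).1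
  have hperm : ∀ i, τ.1 i = σ.1 i ∧ σ.2 i = τ.2 i := by
    intro i
    have := hentry i (σ.1 i)
    simp only [ColoredPerm.entry, if_true] at this
    split_ifs at this with h'
    exact ⟨h', by simpa using this⟩
  exact Prod.ext (Equiv.ext fun i => (hperm i).1.symm) (funext fun i => (hperm i).2)

theorem exists_backward_grid (Φ : DifferentialBijection Γ Γ' r) (PQ : TableauPair Γ Γ' b n) :
    ∃ (G : GrowthDiagram V n) (c : Fin n → Fin n → Option (Fin r)),
      (∀ k, G.vert (Fin.last n) k = PQ.1.1.vert k) ∧ (∀ k, G.row (Fin.last n) k = PQ.1.1.mark k) ∧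
      (∀ k, G.vert k (Fin.last n) = PQ.1.2.vert k) ∧ (∀ k, G.col k (Fin.last n) = PQ.1.2.mark k) ∧
      ∀ i j, IsInput Γ Γ' (c i j)
          (G.vert i.castSucc j.castSucc) (G.vert i.castSucc j.succ)
          (G.vert i.succ j.castSucc) (G.row i.castSucc j) (G.col i j.castSucc) ∧
        Φ.LocalRule (c i j)
          (G.vert i.castSucc j.castSucc) (G.vert i.castSucc j.succ)
          (G.vert i.succ j.castSucc) (G.vert i.succ j.succ)
          (G.row i.castSucc j) (G.col i j.castSucc) (G.row i.succ j) (G.col i j.succ) := by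
  obtain ⟨⟨P, Q⟩, hPQ⟩ := PQ
  have hstep : ∀ s t u : V × ℕ × ℕ, ∃ o : V × ℕ × ℕ,
      Γ.IsStep t.1 s.1 t.2.1 → Γ'.IsStep u.1 s.1 u.2.2 →
      ∃ c, IsInput Γ Γ' c o.1 u.1 t.1 o.2.1 o.2.2 ∧
        Φ.LocalRule c o.1 u.1 t.1 s.1 o.2.1 o.2.2 t.2.1 u.2.2 := by
    intro s t u
    by_cases h : Γ.IsStep t.1 s.1 t.2.1 ∧ Γ'.IsStep u.1 s.1 u.2.2
    · obtain ⟨c, z, m, m', h'⟩ := exists_localRule_backward (Φ := Φ) h.1 h.2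
      exact ⟨(z, m, m'), fun _ _ => ⟨c, h'⟩⟩
    · exact ⟨(b, 0, 0), fun h1 h2 => absurd ⟨h1, h2⟩ h⟩
  choose step hstep using hstep
  obtain ⟨F, F1, F2, F3⟩ := exists_grid
    (fun j => (P.vert ⟨n - j, by omega⟩, if h : n - j < n then P.mark ⟨n - j, h⟩ else 0, 0))
    (fun i => (Q.vert ⟨n - (i + 1), by omega⟩, 0,
      if h : n - (i + 1) < n then Q.mark ⟨n - (i + 1), h⟩ else 0)) (fun _ _ => step)
  set G : GrowthDiagram V n := ⟨fun i j => (F i.rev j.rev).1,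
    fun i j => (F i.rev (j.castSucc).rev).2.1, fun i j => (F (i.castSucc).rev j.rev).2.2⟩ with hG
  have g1 : ∀ k, G.vert (Fin.last n) k = P.vert k := by
    intro k
    simp only [hG, Fin.rev_last, Fin.val_zero, F1]
    congr 1
    ext
    simp only [Fin.val_rev]
    omega
  have g2 : ∀ k, G.row (Fin.last n) k = P.mark k := by
    intro k
    simp only [hG, Fin.rev_last, Fin.val_zero, F1]
    simp only [Fin.val_rev, Fin.val_castSucc]
    rw [dif_pos (by omega)]
    congr 1
    ext
    simp only
    omega
  have g3 : ∀ k, G.vert k (Fin.last n) = Q.vert k := by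
    intro k
    induction k using Fin.lastCases with
    | last => rw [g1, hPQ]
    | cast k =>
      simp only [hG, Fin.rev_last, Fin.val_zero, Fin.rev_castSucc, Fin.val_succ, F2]
      simp only [Fin.val_rev]
      congr 1
      ext
      simp only [Fin.val_castSucc]
      omega
  have g4 : ∀ k, G.col k (Fin.last n) = Q.mark k := by
    intro k
    simp only [hG, Fin.rev_last, Fin.val_zero, Fin.rev_castSucc, Fin.val_succ, F2]
    simp only [Fin.val_rev]
    rw [dif_pos (by omega)]
    congr 1
    ext
    simp only
    omega
  have cell : ∀ i j : Fin n,
      Γ.IsStep (G.vert i.succ j.castSucc) (G.vert i.succ j.succ) (G.row i.succ j) →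
      Γ'.IsStep (G.vert i.castSucc j.succ) (G.vert i.succ j.succ) (G.col i j.succ) →
      ∃ c, IsInput Γ Γ' c
          (G.vert i.castSucc j.castSucc) (G.vert i.castSucc j.succ)
          (G.vert i.succ j.castSucc) (G.row i.castSucc j) (G.col i j.castSucc) ∧
        Φ.LocalRule c
          (G.vert i.castSucc j.castSucc) (G.vert i.castSucc j.succ)
          (G.vert i.succ j.castSucc) (G.vert i.succ j.succ)
          (G.row i.castSucc j) (G.col i j.castSucc) (G.row i.succ j) (G.col i j.succ) := by
    intro i j h1 h2
    have := hstep (F i.rev j.rev) (F i.rev (j.rev + 1)) (F (i.rev + 1) j.rev)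
    rw [← F3 i.rev j.rev] at this
    simp only [hG, Fin.rev_castSucc, Fin.rev_succ, Fin.val_castSucc, Fin.val_succ] at h1 h2 ⊢
    exact this h1 h2
  have cols : ∀ i : Fin n,
      (∀ j : Fin n, Γ.IsStep (G.vert i.succ j.castSucc) (G.vert i.succ j.succ) (G.row i.succ j)) →
      ∀ j, Γ'.IsStep (G.vert i.castSucc j) (G.vert i.succ j) (G.col i j) := by
    intro i hr j
    induction j using Fin.reverseInduction with
    | last =>
      rw [g3, g3, g4]
      exact Or.inr ⟨Q.adj i, Q.mark_mem i⟩
    | cast j ih =>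
      obtain ⟨c, hc, -⟩ := cell i j (hr j) ih
      exact hc.2.1
  have rows : ∀ (i : Fin (n + 1)) (j : Fin n),
      Γ.IsStep (G.vert i j.castSucc) (G.vert i j.succ) (G.row i j) := by
    intro i
    induction i using Fin.reverseInduction with
    | last =>
      intro j
      rw [g1, g1, g2]
      exact Or.inr ⟨P.adj j, P.mark_mem j⟩
    | cast i ih =>
      intro j
      obtain ⟨c, hc, -⟩ := cell i j (ih j) (cols i ih j.succ)
      exact hc.1
  choose c hc using fun i j => cell i j (rows i.succ j) (cols i (rows i.succ) j.succ)
  exact ⟨G, c, g1, g2, g3, g4, hc⟩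

theorem exists_isGrowth_of_tableauPair (Φ : DifferentialBijection Γ Γ' r)
    (hh : ∀ v, Γ.h v = Γ'.h v) (hb : Γ.h b = 0) (PQ : TableauPair Γ Γ' b n) :
    ∃ (σ : ColoredPerm n r) (G : GrowthDiagram V n), Φ.IsGrowth b σ G ∧
      (∀ k, G.vert (Fin.last n) k = PQ.1.1.vert k) ∧ (∀ k, G.row (Fin.last n) k = PQ.1.1.mark k) ∧
      (∀ k, G.vert k (Fin.last n) = PQ.1.2.vert k) ∧
      (∀ k, G.col k (Fin.last n) = PQ.1.2.mark k) := by
  obtain ⟨G, c, g1, g2, g3, g4, hc⟩ := exists_backward_grid Φ PQ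
  have cols : ∀ i j, Γ'.IsStep (G.vert i.castSucc j) (G.vert i.succ j) (G.col i j) := by
    intro i j
    induction j using Fin.lastCases with
    | last =>
      rw [g3, g3, g4]
      exact Or.inr ⟨PQ.1.2.adj i, PQ.1.2.mark_mem i⟩
    | cast j => exact (hc i j).1.2.1
  have rows : ∀ i j, Γ.IsStep (G.vert i j.castSucc) (G.vert i j.succ) (G.row i j) := by
    intro i j
    induction i using Fin.lastCases with
    | last =>
      rw [g1, g1, g2]
      exact Or.inr ⟨PQ.1.1.adj j, PQ.1.1.mark_mem j⟩
    | cast i => exact (hc i j).1.1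
  have top : ∀ j, G.vert 0 j = b := by
    intro j
    induction j using Fin.reverseInduction with
    | last => rw [g3, PQ.1.2.start]
    | cast j ih => exact ((rows 0 j).eq_of_h_eq_zero (by rw [ih, hb])).trans ih
  have left : ∀ i, G.vert i 0 = b := by
    intro i
    induction i using Fin.reverseInduction with
    | last => rw [g1, PQ.1.1.start]
    | cast i ih => exact ((cols i 0).eq_of_h_eq_zero (by rw [ih, ← hh, hb])).trans ih
  have hrow : ∀ i, ∃! j, c i j ≠ none := by
    intro i
    refine existsUnique_drop (d := fun j => G.vert i.castSucc j = G.vert i.succ j) ?_ ?_ ?_ ?_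
    · rw [left, left]
    · rw [g3, g3]
      exact (PQ.1.2.adj i).ne
    · intro j
      rw [not_not]
      exact ((hc i j).2.output (hc i j).1).2.2.2
    · exact fun j hj => ((hc i j).1.2.2 hj).1
  have hcol : ∀ j, ∃! i, c i j ≠ none := by
    intro j
    refine existsUnique_drop (d := fun i => G.vert i j.castSucc = G.vert i j.succ) ?_ ?_ ?_ ?_
    · rw [top, top]
    · rw [g1, g1]
      exact (PQ.1.1.adj j).ne
    · intro i
      rw [not_not]
      exact ((hc i j).2.output (hc i j).1).2.2.1
    · exact fun i hi => ((hc i j).1.2.2 hi).2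
  choose f hf hf' using hrow
  choose g hg hg' using hcol
  let s : Equiv.Perm (Fin n) := ⟨f, g, fun i => (hg' _ _ (hf i)).symm, fun j => (hf' _ _ (hg j)).symm⟩
  let σ : ColoredPerm n r := (s, fun i => (c i (f i)).get (Option.isSome_iff_ne_none.2 (hf i)))
  have hσ : ∀ i j, σ.entry i j = c i j := by
    intro i j
    by_cases hij : f i = j
    · subst hij
      simp [ColoredPerm.entry, σ, s]
    · have h1 : c i j = none := by_contra fun h => hij (hf' i j h).symm
      simp [ColoredPerm.entry, σ, s, hij, h1]
  refine ⟨σ, G, ⟨top, left, fun j => ?_, fun i => ?_, fun i j => ?_⟩, g1, g2, g3, g4⟩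
  · have := rows 0 j
    rw [top, top] at this
    exact this.eq_zero
  · have := cols i 0
    rw [left, left] at this
    exact this.eq_zero
  · rw [hσ]
    exact (hc i j).2

/-- The pair of tableaux on the south and east edges of a growth diagram. -/
def IsGrowth.tableauPair {σ : ColoredPerm n r} {G : GrowthDiagram V n}
    (h : Φ.IsGrowth b σ G) : TableauPair Γ Γ' b n :=
  have hr : ∀ j : Fin n, G.vert (Fin.last n) j.castSucc ≠ G.vert (Fin.last n) j.succ := fun j hj => by
    have := (h.isPreGrowth.regular.1 _ _).2.1 hj
    simp only [Fin.val_last] at this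
    omega
  have hc : ∀ i : Fin n, G.vert i.castSucc (Fin.last n) ≠ G.vert i.succ (Fin.last n) := fun j hj => by
    have := (h.isPreGrowth.regular.2 _ _).2.1 hj
    simp only [Fin.val_last] at this
    omega
  ⟨({ vert := G.vert (Fin.last n)
      mark := G.row (Fin.last n)
      start := h.2.1 _
      adj := fun j => ((h.isPreGrowth.regular.1 _ j).1.edge (hr j)).1
      mark_mem := fun j => ((h.isPreGrowth.regular.1 _ j).1.edge (hr j)).2 },
    { vert := fun k => G.vert k (Fin.last n)
      mark := fun k => G.col k (Fin.last n)
      start := h.1 _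
      adj := fun j => ((h.isPreGrowth.regular.2 j _).1.edge (hc j)).1
      mark_mem := fun j => ((h.isPreGrowth.regular.2 j _).1.edge (hc j)).2 }), rfl⟩

theorem _root_.Tableau.ext' {P P₂ : Tableau Γ b n} (h1 : ∀ k, P.vert k = P₂.vert k)
    (h2 : ∀ k, P.mark k = P₂.mark k) : P = P₂ := by
  cases P
  cases P₂
  congr
  · exact funext h1
  · exact funext h2

/-- Fomin's theorem: growth diagrams of a differential bijection define a Schensted bijection. -/
theorem inducesSchensted (Φ : DifferentialBijection Γ Γ' r) (hh : ∀ v, Γ.h v = Γ'.h v)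
    (hb : Γ.h b = 0) : Φ.InducesSchensted b := by
  intro n
  choose G hG using fun σ : ColoredPerm n r => exists_isGrowth Φ b σ
  refine ⟨fun σ => ⟨G σ, hG σ, fun G₂ h₂ => h₂.unique (hG σ)⟩, ?_⟩
  refine ⟨Equiv.ofBijective (fun σ => (hG σ).tableauPair) ⟨?_, ?_⟩, ?_⟩
  · intro σ τ h
    have h1 : (hG σ).tableauPair.1.1 = (hG τ).tableauPair.1.1 := congrArg (fun t => t.1.1) h
    have h2 : (hG σ).tableauPair.1.2 = (hG τ).tableauPair.1.2 := congrArg (fun t => t.1.2) h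
    exact (hG σ).perm_unique (hG τ) (congrFun (congrArg Tableau.vert h1))
      (congrFun (congrArg Tableau.mark h1)) (congrFun (congrArg Tableau.vert h2))
      (congrFun (congrArg Tableau.mark h2))
  · intro PQ
    obtain ⟨σ, G₂, h₂, g1, g2, g3, g4⟩ := exists_isGrowth_of_tableauPair Φ hh hb PQ
    refine ⟨σ, Subtype.ext (Prod.ext (Tableau.ext' ?_ ?_) (Tableau.ext' ?_ ?_))⟩ <;>
      simpa [IsGrowth.tableauPair, (hG σ).unique h₂]
  · intro σ G₂ h₂
    obtain rfl := (hG σ).unique h₂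
    exact ⟨fun _ => rfl, fun _ => rfl, fun _ => rfl, fun _ => rfl⟩

end DifferentialBijection

end GrowthDiagrams

section Folding

open Finset

theorem apply_eq_of_sameCycle {α : Type*} {J : Type*} [Finite J] {π : Equiv.Perm J} {F : J → α}
    (hF : ∀ j, F (π j) = F j) {j k : J} (h : π.SameCycle j k) : F j = F k := by
  obtain ⟨n, rfl⟩ := h.exists_nat_pow_eq
  induction n with
  | zero => rfl
  | succ n ih =>
    rw [pow_succ', Equiv.Perm.mul_apply, hF]
    exact ih ⟨n, by simp⟩

theorem exists_equiv_of_fiber_bijOn {I J X Y : Type*} {p : J → I} {a : I → X} (ha : Function.Injective a)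
    {b : J → Y} (hb : Function.Injective b) {cA : I → Prop} {cB : J → Prop}
    (hc : ∀ j, cA (p j) ↔ cB j) {NA KA : I → ℕ} {NB KB : J → ℕ} {σ : I → ℕ → J × ℕ}
    {κ : J → ℕ → ℕ}
    (hσ : ∀ i, cA i → Set.BijOn (σ i) (Set.Icc 1 (NA i))
      {e | p e.1 = i ∧ e.2 ∈ Set.Icc 1 (NB e.1)})
    (hκ : ∀ j, cA (p j) → Set.BijOn (κ j) (Set.Icc 1 (KA (p j))) (Set.Icc 1 (KB j)))
    {SA : Set (X × ℕ × ℕ)} {SB : Set (Y × ℕ × ℕ)}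
    (hSA : ∀ t, t ∈ SA ↔ ∃ i, t.1 = a i ∧ cA i ∧ t.2.1 ∈ Set.Icc 1 (NA i) ∧
      t.2.2 ∈ Set.Icc 1 (KA i))
    (hSB : ∀ t, t ∈ SB ↔ ∃ j, t.1 = b j ∧ cB j ∧ t.2.1 ∈ Set.Icc 1 (NB j) ∧
      t.2.2 ∈ Set.Icc 1 (KB j)) :
    ∃ e : SA ≃ SB, ∀ (t : SA) (i : I), t.1.1 = a i → (e t).1 =
      (b (σ i t.1.2.1).1, (σ i t.1.2.1).2, κ (σ i t.1.2.1).1 t.1.2.2) := by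
  have hex : ∀ t : SA, ∃ u : SB, ∀ i, t.1.1 = a i → u.1 =
      (b (σ i t.1.2.1).1, (σ i t.1.2.1).2, κ (σ i t.1.2.1).1 t.1.2.2) := by
    rintro ⟨⟨x, m, m'⟩, ht⟩
    obtain ⟨i, rfl, hi, hm, hm'⟩ := (hSA _).1 ht
    obtain ⟨h1, h2⟩ := (hσ i hi).mapsTo hm
    have hi' := hi
    simp only at h1 h2 hm hm'
    rw [← h1] at hi' hm'
    refine ⟨⟨_, (hSB (b (σ i m).1, (σ i m).2, κ (σ i m).1 m')).2
      ⟨_, rfl, (hc _).1 hi', h2, (hκ _ hi').mapsTo hm'⟩⟩, fun k hk => ?_⟩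
    rw [← ha hk]
  choose F hF using hex
  refine ⟨Equiv.ofBijective F ⟨?_, ?_⟩, hF⟩
  · rintro ⟨⟨x, m, m'⟩, ht⟩ ⟨⟨x₂, m₂, m₂'⟩, ht₂⟩ h
    obtain ⟨i, hx, hi, hm, hm'⟩ := (hSA _).1 ht
    obtain ⟨i₂, hx₂, hi₂, hm₂, hm₂'⟩ := (hSA _).1 ht₂
    have e := congrArg Subtype.val h
    rw [hF _ i hx, hF _ i₂ hx₂] at e
    simp only [Prod.mk.injEq] at e hx hx₂
    obtain ⟨e1, e2, e3⟩ := e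
    have e1 := hb e1
    have p1 := ((hσ i hi).mapsTo hm).1
    have p2 := ((hσ i₂ hi₂).mapsTo hm₂).1
    simp only at p1 p2 hm hm₂ hm' hm₂'
    have hii : i = i₂ := by rw [← p1, ← p2, e1]
    subst hii
    have hmm : m = m₂ := (hσ i hi).injOn hm hm₂ (Prod.ext e1 e2)
    subst hmm
    subst hx hx₂
    rw [← p1] at hi hm' hm₂'
    have := (hκ _ hi).injOn hm' hm₂' e3
    subst this
    rfl
  · rintro ⟨⟨y, n, n'⟩, ht⟩
    obtain ⟨j, hy, hj, hn, hn'⟩ := (hSB _).1 ht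
    simp only at hy hn hn'
    subst hy
    have hj := (hc j).2 hj
    obtain ⟨m, hm, hmn⟩ := (hσ (p j) hj).surjOn (show (j, n) ∈ _ from ⟨rfl, hn⟩)
    obtain ⟨m', hm', hmn'⟩ := (hκ j hj).surjOn hn'
    refine ⟨⟨(a (p j), m, m'), (hSA _).2 ⟨p j, rfl, hj, hm, hm'⟩⟩, Subtype.ext ?_⟩
    rw [hF _ (p j) rfl]
    simp [hmn, hmn']

variable {I J : Type*} [DecidableEq I] [Fintype J]
  {A : GCM I} {B : GCM J} {π : Equiv.Perm J} {p : J → I}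

namespace IsFolding

theorem apply_perm (hA : IsFolding A B π p) (j : J) : p (π j) = p j :=
  (hA.orbit _ _).2 ⟨-1, by simp⟩

theorem sum_perm_fiber {M : Type*} [AddCommMonoid M] (hA : IsFolding A B π p) (i : I) (F : J → M) :
    ∑ k with p k = i, F (π k) = ∑ k with p k = i, F k := by
  rw [sum_filter, sum_filter, ← Equiv.sum_comp π (fun k => if p k = i then F k else 0)]
  simp [hA.apply_perm]

theorem sum_column (hπ : IsAdmissible B π) (hA : IsFolding A B π p) (i' : I) (j : J) :
    ∑ k with p k = i', B.a k j = A.a i' (p j) := by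
  have hconst : ∀ k, p k = p j → ∑ l with p l = i', B.a l k = ∑ l with p l = i', B.a l j := by
    intro k hk
    refine apply_eq_of_sameCycle (π := π) (F := fun k => ∑ l with p l = i', B.a l k) (fun k => ?_)
      ((hA.orbit k j).1 hk)
    rw [← hA.sum_perm_fiber]
    simp [hπ.aut]
  obtain ⟨j', hj'⟩ := hA.surj i'
  have hne : ((univ.filter fun k => p k = p j).card : ℚ) ≠ 0 := by
    rw [Nat.cast_ne_zero, card_ne_zero]
    exact ⟨j, by simp⟩
  have hne' : ((univ.filter fun k => p k = i').card : ℚ) ≠ 0 := by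
    rw [Nat.cast_ne_zero, card_ne_zero]
    exact ⟨j', by simpa using hj'⟩
  have hrow : ∀ l, p l = i' → (∑ k with p k = p j, (B.a l k : ℚ)) =
      A.a i' (p j) * (univ.filter fun k => p k = p j).card /
        (univ.filter fun k => p k = i').card := by
    intro l hl
    rw [hA.entry i' (p j) l hl]
    field_simp
  have hdouble : ∑ k with p k = p j, ∑ l with p l = i', (B.a l k : ℚ) =
      ∑ l with p l = i', ∑ k with p k = p j, (B.a l k : ℚ) := sum_comm
  rw [sum_congr rfl fun k hk => by
      rw [← Int.cast_sum, hconst k (mem_filter.1 hk).2],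
    sum_congr rfl fun l hl => hrow l (mem_filter.1 hl).2, sum_const, sum_const, nsmul_eq_mul,
    nsmul_eq_mul] at hdouble
  field_simp at hdouble
  exact_mod_cast hdouble

theorem sum_column_mul [Fintype I] (hπ : IsAdmissible B π) (hA : IsFolding A B π p) (x : I → ℤ)
    (j : J) : ∑ k, B.a k j * x (p k) = ∑ i, A.a i (p j) * x i := by
  rw [← sum_fiberwise univ p]
  refine sum_congr rfl fun i _ => ?_
  rw [← hA.sum_column hπ i j, sum_mul]
  exact sum_congr rfl fun k hk => by rw [(mem_filter.1 hk).2]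

theorem isCentral [DecidableEq J] [Fintype I] (hπ : IsAdmissible B π) (hA : IsFolding A B π p) {K : I → ℕ}
    (hK : A.IsCentral K) : B.IsCentral (foldCoroot p K) := by
  intro j
  have h := hA.sum_column_mul hπ (fun i => (K i : ℤ)) j
  have h2 := hK (p j)
  simp only [foldCoroot, mul_comm _ (B.a _ _)]
  simp only [mul_comm _ (A.a _ _)] at h2
  rw [h, h2]

end IsFolding

theorem exists_bijOn_fiber (p : J → I) (i : I) (j : J) (N : J → ℕ) {n : ℕ}
    (hn : n = ∑ j with p j = i, N j) :
    ∃ g : ℕ → J × ℕ, Set.BijOn g (Set.Icc 1 n) {e | p e.1 = i ∧ e.2 ∈ Set.Icc 1 (N e.1)} := by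
  have : Nonempty (J × ℕ) := ⟨(j, 0)⟩
  have hset : {e : J × ℕ | p e.1 = i ∧ e.2 ∈ Set.Icc 1 (N e.1)} =
      (((univ.filter fun j => p j = i).sigma fun j => Finset.Icc 1 (N j)).map
        (Equiv.sigmaEquivProd J ℕ).toEmbedding : Finset (J × ℕ)) := by
    ext ⟨j, m⟩
    simp
  refine (Set.finite_Icc 1 n).exists_bijOn_of_encard_eq ?_
  rw [hset, Set.encard_coe_eq_coe_finsetCard, ← Finset.coe_Icc, Set.encard_coe_eq_coe_finsetCard]
  simp [card_sigma, hn]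

variable [DecidableEq J]

/-- The product of the commuting simple reflections indexed by a fibre of `p`. -/
noncomputable def orbitReflection (B : GCM J) (p : J → I) (i : I) : B.Weyl :=
  ((univ.filter fun j => p j = i).toList.map B.s).prod

theorem corootAct_prod_map_simple {l : List J} (hl : l.Nodup)
    (horth : ∀ j ∈ l, ∀ k ∈ l, j ≠ k → B.a j k = 0) (x : J → ℤ) (m : J) :
    B.corootAct (l.map B.s).prod x m = if m ∈ l then x m - ∑ k, B.a k m * x k else x m := by
  induction l generalizing m with
  | nil => simp
  | cons j l ih =>
    have ih' := ih hl.of_cons fun a ha b hb =>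
      horth a (List.mem_cons_of_mem _ ha) b (List.mem_cons_of_mem _ hb)
    have hj : j ∉ l := (List.nodup_cons.1 hl).1
    rw [List.map_cons, List.prod_cons, map_mul, Module.End.mul_apply]
    by_cases hm : m = j
    · subst hm
      rw [B.isGeometricRep_corootAct.simple_apply]
      have hsum : ∑ k, B.a k m * B.corootAct (l.map B.s).prod x k = ∑ k, B.a k m * x k := by
        refine sum_congr rfl fun k _ => ?_
        rw [ih']
        split_ifs with hk
        · rw [horth k (List.mem_cons_of_mem _ hk) m List.mem_cons_self
            (fun h => hj (h ▸ hk)), zero_mul, zero_mul]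
        · rfl
      simp only [Pi.sub_apply, Pi.smul_apply, Pi.single_eq_same, smul_eq_mul, mul_one,
        List.mem_cons_self, if_true, GCM.transpose, Matrix.transpose_apply]
      rw [hsum, ih', if_neg hj]
    · rw [B.isGeometricRep_corootAct.simple_apply_of_ne hm, ih']
      simp [hm]

namespace IsFolding

theorem corootAct_prod (hπ : IsAdmissible B π) (hA : IsFolding A B π p) {i : I} {l : List J}
    (hl : l.Nodup) (hmem : ∀ j, j ∈ l ↔ p j = i) (x : J → ℤ) (m : J) :
    B.corootAct (l.map B.s).prod x m = if p m = i then x m - ∑ k, B.a k m * x k else x m := by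
  rw [corootAct_prod_map_simple hl]
  · simp only [hmem]
  intro j hj k hk hjk
  exact hπ.orbit j k hjk ((hA.orbit j k).1 (((hmem j).1 hj).trans ((hmem k).1 hk).symm))

theorem corootAct_orbitReflection (hπ : IsAdmissible B π) (hA : IsFolding A B π p) (i : I)
    (x : J → ℤ) (m : J) : B.corootAct (orbitReflection B p i) x m =
      if p m = i then x m - ∑ k, B.a k m * x k else x m :=
  hA.corootAct_prod hπ (nodup_toList _) (by simp) x m

theorem prod_eq_orbitReflection (hπ : IsAdmissible B π) (hA : IsFolding A B π p) {i : I}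
    {l : List J} (hl : l.Nodup) (hmem : ∀ j, j ∈ l ↔ p j = i) :
    (l.map B.s).prod = orbitReflection B p i := by
  refine B.isGeometricRep_corootAct.injective (LinearMap.ext fun x => funext fun m => ?_)
  rw [hA.corootAct_prod hπ hl hmem, hA.corootAct_orbitReflection hπ]

theorem corootAct_orbitReflection_perm (hπ : IsAdmissible B π) (hA : IsFolding A B π p) (i : I)
    (x : J → ℤ) : B.corootAct (orbitReflection B p i) (x ∘ π) =
      B.corootAct (orbitReflection B p i) x ∘ π := by
  funext m
  rw [Function.comp_apply, hA.corootAct_orbitReflection hπ, hA.corootAct_orbitReflection hπ,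
    hA.apply_perm, ← Equiv.sum_comp π (fun k => B.a k (π m) * x k)]
  simp [hπ.aut]

variable [Fintype I]

theorem corootAct_orbitReflection_comp (hπ : IsAdmissible B π) (hA : IsFolding A B π p) (i : I)
    (x : I → ℤ) : B.corootAct (orbitReflection B p i) (x ∘ p) = A.corootAct (A.s i) x ∘ p := by
  funext m
  rw [hA.corootAct_orbitReflection hπ, Function.comp_apply,
    A.isGeometricRep_corootAct.simple_apply]
  simp only [Function.comp_apply]
  rw [hA.sum_column_mul hπ]
  split_ifs with h
  · subst h
    simp [GCM.transpose]
  · simp [h]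

omit [Fintype I] in
theorem corootAct_nonneg_iff (hA : IsFolding A B π p) {g : B.Weyl}
    (hg : ∀ x, B.corootAct g (x ∘ π) = B.corootAct g x ∘ π) {j : J} {i : I} (hj : p j = i) :
    0 ≤ B.corootAct g (Pi.single j 1) ↔ 0 ≤ B.corootAct g ((Pi.single i 1 : I → ℤ) ∘ p) := by
  have hB := B.isGeometricRep_corootAct
  have hsum : (Pi.single i 1 : I → ℤ) ∘ p = ∑ k with p k = i, (Pi.single k 1 : J → ℤ) := by
    funext m
    simp [Finset.sum_apply, Pi.single_apply]
  have hinv : ∀ k, (0 ≤ B.corootAct g (Pi.single (π k) 1)) = (0 ≤ B.corootAct g (Pi.single k 1)) := by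
    intro k
    have h1 : (Pi.single (π k) 1 : J → ℤ) ∘ π = Pi.single k 1 := by
      funext m
      simp [Pi.single_apply]
    rw [← h1, hg]
    refine propext ⟨fun h m => h (π m), fun h m => ?_⟩
    have := h (π.symm m)
    rwa [Function.comp_apply, Equiv.apply_symm_apply] at this
  have hconst : ∀ k, p k = i →
      (0 ≤ B.corootAct g (Pi.single k 1)) = (0 ≤ B.corootAct g (Pi.single j 1)) := fun k hk =>
    apply_eq_of_sameCycle (F := fun k => 0 ≤ B.corootAct g (Pi.single k 1)) hinv
      ((hA.orbit k j).1 (hk.trans hj.symm))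
  constructor
  · intro h
    rw [hsum, map_sum]
    exact sum_nonneg fun k hk => (hconst k (mem_filter.1 hk).2).mpr h
  · intro h
    by_contra hneg
    have h2 : B.corootAct g ((Pi.single i 1 : I → ℤ) ∘ p) ≤ 0 := by
      rw [hsum, map_sum]
      refine sum_nonpos fun k hk => (hB.nonneg_or_nonpos g k).resolve_left fun h3 => hneg ?_
      exact (hconst k (mem_filter.1 hk).2).mp h3
    have h3 := hB.inv_apply_apply g ((Pi.single i 1 : I → ℤ) ∘ p)
    rw [le_antisymm h2 h, map_zero] at h3
    have := congrFun h3 j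
    simp [hj] at this

theorem isLiftable (hπ : IsAdmissible B π) (hA : IsFolding A B π p) :
    A.coxeterMatrix.IsLiftable (orbitReflection B p) := by
  intro i k
  have hcomp : ∀ (n : ℕ) (x : I → ℤ),
      B.corootAct ((orbitReflection B p i * orbitReflection B p k) ^ n) (x ∘ p) =
        A.corootAct ((A.s i * A.s k) ^ n) x ∘ p := by
    intro n
    induction n with
    | zero => simp
    | succ n ih =>
      intro x
      simp only [pow_succ, map_mul, Module.End.mul_apply] at ih ⊢
      rw [hA.corootAct_orbitReflection_comp hπ, hA.corootAct_orbitReflection_comp hπ, ih]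
  have hperm : ∀ (n : ℕ) (x : J → ℤ),
      B.corootAct ((orbitReflection B p i * orbitReflection B p k) ^ n) (x ∘ π) =
        B.corootAct ((orbitReflection B p i * orbitReflection B p k) ^ n) x ∘ π := by
    intro n
    induction n with
    | zero => simp
    | succ n ih =>
      intro x
      simp only [pow_succ, map_mul, Module.End.mul_apply] at ih ⊢
      rw [hA.corootAct_orbitReflection_perm hπ, hA.corootAct_orbitReflection_perm hπ, ih]
  refine B.isGeometricRep_corootAct.eq_one_of_nonneg fun j => ?_
  rw [hA.corootAct_nonneg_iff (hperm _) rfl, hcomp, A.cs.simple_mul_simple_pow, map_one,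
    Module.End.one_apply]
  have h : (0 : I → ℤ) ≤ Pi.single (p j) 1 := Pi.single_nonneg.2 zero_le_one
  exact fun m => h (p m)

/-- The embedding of Weyl groups given by folding. -/
noncomputable def weylHom (hπ : IsAdmissible B π) (hA : IsFolding A B π p) : A.Weyl →* B.Weyl :=
  A.cs.lift ⟨orbitReflection B p, hA.isLiftable hπ⟩

theorem weylHom_simple (hπ : IsAdmissible B π) (hA : IsFolding A B π p) (i : I) :
    hA.weylHom hπ (A.s i) = orbitReflection B p i :=
  A.cs.lift_apply_simple _ i

theorem isFoldHom_weylHom (hπ : IsAdmissible B π) (hA : IsFolding A B π p) :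
    IsFoldHom A B p (hA.weylHom hπ) := fun i l hl hmem => by
  rw [hA.weylHom_simple hπ, hA.prod_eq_orbitReflection hπ hl hmem]

theorem corootAct_weylHom_comp (hπ : IsAdmissible B π) (hA : IsFolding A B π p) (w : A.Weyl)
    (x : I → ℤ) : B.corootAct (hA.weylHom hπ w) (x ∘ p) = A.corootAct w x ∘ p := by
  induction w using A.cs.simple_induction generalizing x with
  | simple i => rw [hA.weylHom_simple hπ, hA.corootAct_orbitReflection_comp hπ]
  | one => simp
  | mul v w hv hw => rw [map_mul, map_mul, map_mul, Module.End.mul_apply, Module.End.mul_apply, hw, hv]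

theorem corootAct_weylHom_perm (hπ : IsAdmissible B π) (hA : IsFolding A B π p) (w : A.Weyl)
    (x : J → ℤ) :
    B.corootAct (hA.weylHom hπ w) (x ∘ π) = B.corootAct (hA.weylHom hπ w) x ∘ π := by
  induction w using A.cs.simple_induction generalizing x with
  | simple i => rw [hA.weylHom_simple hπ, hA.corootAct_orbitReflection_perm hπ]
  | one => simp
  | mul v w hv hw => rw [map_mul, map_mul, Module.End.mul_apply, Module.End.mul_apply, hw, hv]

theorem weylHom_injective (hπ : IsAdmissible B π) (hA : IsFolding A B π p) :
    Function.Injective (hA.weylHom hπ) := by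
  rw [injective_iff_map_eq_one]
  intro w hw
  apply A.isGeometricRep_corootAct.injective
  rw [map_one]
  refine LinearMap.ext fun x => hA.surj.injective_comp_right ?_
  have := hA.corootAct_weylHom_comp hπ w x
  rw [hw, map_one] at this
  exact this.symm

theorem corootAct_weylHom_nonneg_iff (hπ : IsAdmissible B π) (hA : IsFolding A B π p) (w : A.Weyl)
    (j : J) : 0 ≤ A.corootAct w (Pi.single (p j) 1) ↔
      0 ≤ B.corootAct (hA.weylHom hπ w) (Pi.single j 1) := by
  rw [hA.corootAct_nonneg_iff (hA.corootAct_weylHom_perm hπ w) rfl, hA.corootAct_weylHom_comp hπ]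
  refine ⟨fun h m => h (p m), fun h i => ?_⟩
  obtain ⟨m, rfl⟩ := hA.surj i
  exact h m

theorem length_simple_mul_weylHom_iff (hπ : IsAdmissible B π) (hA : IsFolding A B π p) (v : A.Weyl)
    (j : J) : A.len (A.s (p j) * v) = A.len v + 1 ↔
      B.len (B.s j * hA.weylHom hπ v) = B.len (hA.weylHom hπ v) + 1 := by
  rw [← A.corootAct_inv_nonneg_iff, ← B.corootAct_inv_nonneg_iff, ← map_inv,
    hA.corootAct_weylHom_nonneg_iff hπ]

theorem weakCover_out_iff (hπ : IsAdmissible B π) (hA : IsFolding A B π p) (v : A.Weyl) (j : J) :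
    A.WeakCover v (A.s (p j) * v) ↔
      B.WeakCover (hA.weylHom hπ v) (B.s j * hA.weylHom hπ v) := by
  rw [GCM.weakCover_simple_mul_iff, GCM.weakCover_simple_mul_iff,
    hA.length_simple_mul_weylHom_iff hπ]

theorem weakCover_in_iff (hπ : IsAdmissible B π) (hA : IsFolding A B π p) (v : A.Weyl) (j : J) :
    A.WeakCover (A.s (p j) * v) v ↔
      B.WeakCover (B.s j * hA.weylHom hπ v) (hA.weylHom hπ v) := by
  rw [GCM.weakCover_simple_mul_iff', GCM.weakCover_simple_mul_iff',
    hA.length_simple_mul_weylHom_iff hπ]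

theorem sum_corootPairing_weylHom (hπ : IsAdmissible B π) (hA : IsFolding A B π p) (w : A.Weyl)
    (i : I) (j' : J) :
    ∑ j with p j = i, B.corootPairing (Pi.single j' 1) (hA.weylHom hπ w) j =
      A.corootPairing (Pi.single (p j') 1) w i := by
  have hsum : (Pi.single i 1 : I → ℤ) ∘ p = ∑ k with p k = i, (Pi.single k 1 : J → ℤ) := by
    funext m
    simp [Finset.sum_apply, Pi.single_apply]
  have h := congrFun (hA.corootAct_weylHom_comp hπ w (Pi.single i 1)) j'
  rw [hsum, map_sum, Finset.sum_apply] at h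
  simpa [GCM.corootPairing, Pi.single_apply] using h

theorem strongMult_out (hπ : IsAdmissible B π) (hA : IsFolding A B π p) (j' : J) {v : A.Weyl}
    {i : I} (h : A.WeakCover v (A.s i * v)) :
    A.strongMult (Pi.single (p j') 1) v (A.s i * v) = ∑ j with p j = i,
      B.strongMult (Pi.single j' 1) (hA.weylHom hπ v) (B.s j * hA.weylHom hπ v) := by
  zify
  rw [GCM.strongMult_simple_mul _ h.2, ← hA.sum_corootPairing_weylHom hπ, map_inv]
  refine sum_congr rfl fun j hj => ?_
  obtain rfl := (mem_filter.1 hj).2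
  rw [GCM.strongMult_simple_mul _ ((hA.weakCover_out_iff hπ v j).1 h).2]

theorem strongMult_in (hπ : IsAdmissible B π) (hA : IsFolding A B π p) (j' : J) {v : A.Weyl}
    {i : I} (h : A.WeakCover (A.s i * v) v) :
    A.strongMult (Pi.single (p j') 1) (A.s i * v) v = ∑ j with p j = i,
      B.strongMult (Pi.single j' 1) (B.s j * hA.weylHom hπ v) (hA.weylHom hπ v) := by
  zify
  rw [GCM.strongMult_simple_mul_self _ h, ← hA.sum_corootPairing_weylHom hπ, map_inv,
    ← sum_neg_distrib]
  refine sum_congr rfl fun j hj => ?_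
  obtain rfl := (mem_filter.1 hj).2
  rw [GCM.strongMult_simple_mul_self _ ((hA.weakCover_in_iff hπ v j).1 h)]

end IsFolding

namespace GCM

variable [Fintype I]

theorem mem_UD_self_iff (Λ K : I → ℕ) (v : A.Weyl) (t : A.Weyl × ℕ × ℕ) :
    t ∈ (A.strongGraph Λ).UD (A.weakGraph K) v v ↔ ∃ i, t.1 = A.s i * v ∧
      A.WeakCover (A.s i * v) v ∧ t.2.1 ∈ Set.Icc 1 (A.strongMult Λ (A.s i * v) v) ∧
      t.2.2 ∈ Set.Icc 1 (A.weakMult K (A.s i * v) v) := by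
  obtain ⟨z, m, m'⟩ := t
  constructor
  · rintro ⟨-, h2, h3, h4⟩
    obtain ⟨i, hi⟩ := h2.1
    have hz : z = A.s i * v := by
      rw [hi]
      exact (A.cs.simple_mul_simple_cancel_left i).symm
    subst hz
    exact ⟨i, rfl, h2, h3, h4⟩
  · rintro ⟨i, hz, h2, h3, h4⟩
    simp only at hz
    subst hz
    exact ⟨h2.strongCover, h2, h3, h4⟩

theorem mem_DU_self_iff (Λ K : I → ℕ) (v : A.Weyl) (t : A.Weyl × ℕ × ℕ) :
    t ∈ (A.strongGraph Λ).DU (A.weakGraph K) v v ↔ ∃ i, t.1 = A.s i * v ∧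
      A.WeakCover v (A.s i * v) ∧ t.2.1 ∈ Set.Icc 1 (A.strongMult Λ v (A.s i * v)) ∧
      t.2.2 ∈ Set.Icc 1 (A.weakMult K v (A.s i * v)) := by
  obtain ⟨w, m, m'⟩ := t
  constructor
  · rintro ⟨-, h2, h3, h4⟩
    obtain ⟨i, hi⟩ := h2.1
    simp only at hi
    subst hi
    exact ⟨i, rfl, h2, h3, h4⟩
  · rintro ⟨i, hw, h2, h3, h4⟩
    simp only at hw
    subst hw
    exact ⟨h2.strongCover, h2, h3, h4⟩

theorem simple_mul_injective (v : A.Weyl) : Function.Injective fun i => A.s i * v :=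
  fun _ _ h => simple_injective (mul_right_cancel h)

end GCM

namespace IsFolding

variable [Fintype I]

theorem nonempty_foldIdent (hπ : IsAdmissible B π) (hA : IsFolding A B π p) (K : I → ℕ) (j' : J) :
    Nonempty (FoldIdent A B p (hA.weylHom hπ) K (p j') j') := by
  have hout : ∀ v i, ∃ g : ℕ → J × ℕ, A.WeakCover v (A.s i * v) → Set.BijOn g
      (Set.Icc 1 (A.strongMult (Pi.single (p j') 1) v (A.s i * v)))
      {e | p e.1 = i ∧ e.2 ∈ Set.Icc 1
        (B.strongMult (Pi.single j' 1) (hA.weylHom hπ v) (B.s e.1 * hA.weylHom hπ v))} := by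
    intro v i
    by_cases h : A.WeakCover v (A.s i * v)
    · obtain ⟨g, hg⟩ := exists_bijOn_fiber p i j'
        (fun j => B.strongMult (Pi.single j' 1) (hA.weylHom hπ v) (B.s j * hA.weylHom hπ v))
        (hA.strongMult_out hπ j' h)
      exact ⟨g, fun _ => hg⟩
    · exact ⟨fun _ => (j', 0), fun h' => absurd h' h⟩
  have hin : ∀ v i, ∃ g : ℕ → J × ℕ, A.WeakCover (A.s i * v) v → Set.BijOn g
      (Set.Icc 1 (A.strongMult (Pi.single (p j') 1) (A.s i * v) v))
      {e | p e.1 = i ∧ e.2 ∈ Set.Icc 1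
        (B.strongMult (Pi.single j' 1) (B.s e.1 * hA.weylHom hπ v) (hA.weylHom hπ v))} := by
    intro v i
    by_cases h : A.WeakCover (A.s i * v) v
    · obtain ⟨g, hg⟩ := exists_bijOn_fiber p i j'
        (fun j => B.strongMult (Pi.single j' 1) (B.s j * hA.weylHom hπ v) (hA.weylHom hπ v))
        (hA.strongMult_in hπ j' h)
      exact ⟨g, fun _ => hg⟩
    · exact ⟨fun _ => (j', 0), fun h' => absurd h' h⟩
  choose so hso using hout
  choose si hsi using hin
  exact ⟨{
    strongOut := so
    strongIn := si
    weakOut := fun _ _ => id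
    weakIn := fun _ _ => id
    strongOut_bij := hso
    strongIn_bij := hsi
    weakOut_bij := fun v j _ => by
      rw [GCM.weakMult_simple_mul, GCM.weakMult_simple_mul]
      exact Set.bijOn_id _
    weakIn_bij := fun v j _ => by
      rw [GCM.weakMult_simple_mul_self, GCM.weakMult_simple_mul_self]
      exact Set.bijOn_id _ }⟩

variable {K : I → ℕ} {i' : I} {j' : J}

theorem exists_isUDBij (hπ : IsAdmissible B π) (hA : IsFolding A B π p)
    (ι : FoldIdent A B p (hA.weylHom hπ) K i' j') :
    ∃ ud : ∀ v : A.Weyl, ι.UDA v ≃ ι.UDB v, ι.IsUDBij ud := by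
  choose ud hud using fun v => exists_equiv_of_fiber_bijOn (GCM.simple_mul_injective v)
    (GCM.simple_mul_injective (hA.weylHom hπ v)) (hA.weakCover_in_iff hπ v) (ι.strongIn_bij v)
    (ι.weakIn_bij v) (GCM.mem_UD_self_iff _ _ v) (GCM.mem_UD_self_iff _ _ (hA.weylHom hπ v))
  exact ⟨ud, hud⟩

theorem exists_isDUBij (hπ : IsAdmissible B π) (hA : IsFolding A B π p)
    (ι : FoldIdent A B p (hA.weylHom hπ) K i' j') :
    ∃ du : ∀ v : A.Weyl, ι.DUA v ≃ ι.DUB v, ι.IsDUBij du := by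
  choose du hdu using fun v => exists_equiv_of_fiber_bijOn (GCM.simple_mul_injective v)
    (GCM.simple_mul_injective (hA.weylHom hπ v)) (hA.weakCover_out_iff hπ v) (ι.strongOut_bij v)
    (ι.weakOut_bij v) (GCM.mem_DU_self_iff _ _ v) (GCM.mem_DU_self_iff _ _ (hA.weylHom hπ v))
  exact ⟨du, hdu⟩

end IsFolding

namespace FoldIdent

variable [Fintype I] {f : A.Weyl →* B.Weyl} {K : I → ℕ} {i' : I} {j' : J}

/-- The folded differential bijection. -/
noncomputable def restriction (ι : FoldIdent A B p f K i' j') (ud : ∀ v : A.Weyl, ι.UDA v ≃ ι.UDB v)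
    (du : ∀ v : A.Weyl, ι.DUA v ≃ ι.DUB v) {r : ℕ}
    (ΦB : DifferentialBijection (B.strongGraph (Pi.single j' 1))
      (B.weakGraph (foldCoroot p K)) r) :
    DifferentialBijection (A.strongGraph (Pi.single i' 1)) (A.weakGraph K) r where
  off := A.naturalOffDiag (Pi.single i' 1) K
  diag v := (((Equiv.refl (Fin r)).sumCongr (ud v)).trans (ΦB.diag (f v))).trans (du v).symm

theorem isRestriction_restriction (ι : FoldIdent A B p f K i' j')
    (ud : ∀ v : A.Weyl, ι.UDA v ≃ ι.UDB v) (du : ∀ v : A.Weyl, ι.DUA v ≃ ι.DUB v) {r : ℕ}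
    (ΦB : DifferentialBijection (B.strongGraph (Pi.single j' 1))
      (B.weakGraph (foldCoroot p K)) r) :
    ι.IsRestriction ud du ΦB (ι.restriction ud du ΦB) :=
  ⟨fun _ _ _ _ => rfl, fun v => by simp [restriction, Equiv.trans_assoc]⟩

theorem IsRestriction.unique {ι : FoldIdent A B p f K i' j'}
    {ud : ∀ v : A.Weyl, ι.UDA v ≃ ι.UDB v} {du : ∀ v : A.Weyl, ι.DUA v ≃ ι.DUB v} {r : ℕ}
    {ΦB : DifferentialBijection (B.strongGraph (Pi.single j' 1)) (B.weakGraph (foldCoroot p K)) r}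
    {Φ Ψ : DifferentialBijection (A.strongGraph (Pi.single i' 1)) (A.weakGraph K) r}
    (hΦ : ι.IsRestriction ud du ΦB Φ) (hΨ : ι.IsRestriction ud du ΦB Ψ) : Φ = Ψ := by
  have hoff : Φ.off = Ψ.off := by
    funext x y hxy
    exact Equiv.ext fun t => Subtype.ext ((hΦ.1 x y hxy t).trans (hΨ.1 x y hxy t).symm)
  have hdiag : Φ.diag = Ψ.diag := by
    funext v
    refine Equiv.ext fun t => (du v).injective ?_
    exact congrArg (fun e : _ ≃ _ => e t) ((hΦ.2 v).trans (hΨ.2 v).symm)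
  cases Φ
  cases Ψ
  congr

end FoldIdent

end Folding

theorem propositionP {I J : Type*} [Fintype I] [DecidableEq I] [Fintype J] [DecidableEq J]
    (A : GCM I) (B : GCM J) (π : Equiv.Perm J) (hπ : IsAdmissible B π)
    (p : J → I) (hA : IsFolding A B π p) (K : I → ℕ) (hK : A.IsCentral K)
    (i' : I) (j' : J) (hj' : p j' = i') :
    B.IsCentral (foldCoroot p K) ∧
    GradedGraph.IsDual (B.strongGraph (Pi.single j' 1)) (B.weakGraph (foldCoroot p K)) (K i') ∧
    GradedGraph.IsDual (A.strongGraph (Pi.single i' 1)) (A.weakGraph K) (K i') ∧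
    ∃ f : A.Weyl →* B.Weyl, IsFoldHom A B p f ∧ Function.Injective f ∧
      Nonempty (FoldIdent A B p f K i' j') ∧
      ∀ ι : FoldIdent A B p f K i' j',
        ∃ (ud : ∀ v : A.Weyl, ι.UDA v ≃ ι.UDB v) (du : ∀ v : A.Weyl, ι.DUA v ≃ ι.DUB v),
          ι.IsUDBij ud ∧ ι.IsDUBij du ∧
          ∀ ΦB : DifferentialBijection (B.strongGraph (Pi.single j' 1))
              (B.weakGraph (foldCoroot p K)) (K i'),
            ∃ ΦA : DifferentialBijection (A.strongGraph (Pi.single i' 1)) (A.weakGraph K) (K i'),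
              ι.IsRestriction ud du ΦB ΦA ∧
              (∀ Φ', ι.IsRestriction ud du ΦB Φ' → Φ' = ΦA) ∧
              ΦA.InducesSchensted 1 := by
  subst hj'
  have hB := hA.isCentral hπ hK
  refine ⟨hB, GCM.isDual_strongGraph_weakGraph hB j', GCM.isDual_strongGraph_weakGraph hK (p j'),
    hA.weylHom hπ, hA.isFoldHom_weylHom hπ, hA.weylHom_injective hπ,
    hA.nonempty_foldIdent hπ K j', fun ι => ?_⟩
  obtain ⟨ud, hud⟩ := hA.exists_isUDBij hπ ι
  obtain ⟨du, hdu⟩ := hA.exists_isDUBij hπ ι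
  refine ⟨ud, du, hud, hdu, fun ΦB => ?_⟩
  have hres := ι.isRestriction_restriction ud du ΦB
  exact ⟨ι.restriction ud du ΦB, hres, fun Φ' h => h.unique hres,
    DifferentialBijection.inducesSchensted _ (fun _ => rfl) A.cs.length_one⟩
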